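/- **Conventions.** The Pauli unitaries on $n$ qubits are $i^r\{I,X,Y,Z\}^{\otimes n}$, the Pauli observables are $\pm\{I,X,Y,Z\}^{\otimes n}$, and a stabilizer group is a group of commuting Pauli observables not containing $-I$. A *stabilizer circuit* is a sequence of allocations of qubits in the zero state, allocations of fair random bits, Clifford unitaries, non-destructive Pauli measurements, deallocations of qubits in the zero state, and Pauli unitaries conditioned on the parity of earlier outcomes. Its outcome vector $v$ lists all measurement outcomes and random bits, and its action is the family of completely positive maps $\rho\mapsto Q_v\rho Q_v^\dagger$, where $Q_v$ is the linear map enacted upon outcome $v$ (outcomes with zero map are discarded). Two circuits are *equivalent* if, after summing the maps over each class of outcomes with proportional maps, their families of maps agree up to a bijection of the outcomes. They *have the same action* upon two given outcome vectors if both can occur and the two maps agree up to a positive factor. An outcome is *random* if, for every input and all previous outcomes, its conditional probability of being zero is $1/2$; it is *redundant* if, for each sequence of previous outcomes, this probability is $0$ for all inputs or $1$ for all inputs. A *general form circuit* on $n$ input and $n$ output qubits with $k$ inner qubits, no random bits, Clifford unitaries $L,R$ and condition matrices $A\in\mathbb F_2^{(n-k)\times(n-k)}$, $A_x,A_z\in\mathbb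 F_2^{k\times(n-k)}$ applies $L^\dagger$, measures the first $n-k$ qubits destructively in the $Z$ basis with outcome vector $m$, applies the Paulis $X^{A_xm}$, $Z^{A_zm}$ to the remaining $k$ qubits, places $n-k$ new qubits in the state $|Am\rangle$ in front of these, and applies $R$. A *common symplectic basis* $\mathcal B$ of two $n$-qubit stabilizer groups $S_{\mathrm{in}}$ and $M$ consists of $2n$ Pauli observables in ten ordered sets $\mathcal Z_\Delta,\mathcal X_\Delta,\mathcal Z_\cap,\mathcal X_\cap,\mathcal Z_S,\mathcal X_S,\mathcal Z_M,\mathcal X_M,\mathcal Z,\mathcal X$ with $|\mathcal Z_\bullet|=|\mathcal X_\bullet|$, such that the concatenations $\mathcal Z_\Delta\oplus\mathcal Z_\cap\oplus\mathcal Z_S\oplus\mathcal Z_M\oplus\mathcal Z$ and $\mathcal X_\Delta\oplus\mathcal X_\cap\oplus\mathcal X_S\oplus\mathcal X_M\oplus\mathcal X$ have the same commutation relations as $Z_1,\dots,Z_n$ and $X_1,\dots,X_n$, and $S_{\mathrm{in}}=\langle\mathcal Z_\Delta\cup\mathcal Z_\cap\cup\mathcal Z_S\rangle$, $M=\langle\mathcal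 X_\Delta\cup\mathcal Z_\cap\cup\mathcal Z_M\rangle$. The circuit $\mathcal S_{\mathcal B}$, with outcome vector $v_S$, measures $\mathcal Z_\Delta,\mathcal Z_\cap,\mathcal Z_S$. The circuit $\mathcal M_{\mathcal B}$, with outcome vector $v_M$, measures $\mathcal X_\Delta,\mathcal Z_\cap,\mathcal Z_M$, and then applies $(\mathcal Z_\Delta)_j$ if the outcome of $(\mathcal X_\Delta)_j$ is one and $(\mathcal X_M)_j$ if the outcome of $(\mathcal Z_M)_j$ is one, for all $j$. By $\mathcal S_{\mathcal B}\circ\mathcal M_{\mathcal B}$ we mean $\mathcal S_{\mathcal B}$ followed by $\mathcal M_{\mathcal B}$, with outcome vector $v_S\oplus v_M$. **Lemma (General form circuit for measuring two stabilizer groups).** Let $S_{\mathrm{in}}$ and $M$ be two $n$-qubit stabilizer groups with a common symplectic basis $\mathcal B$. There is a Clifford unitary that maps the standard Pauli basis to $\mathcal B$ by conjugation, and for every such unitary $C_{\mathcal B}$ the following holds. The stabilizer circuit $\mathcal S_{\mathcal B}\circ\mathcal M_{\mathcal B}$ is equivalent to the general form stabilizer circuit $\mathcal C_{\mathrm{gen}}$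 with: - $k=|\mathcal Z|$ inner qubits and zero random bits; - left and right Clifford unitaries $L=C_{\mathcal B}$ and $R=C_{\mathcal B}\,(H^{\otimes|\mathcal Z_\Delta|}\otimes I_{n-|\mathcal Z_\Delta|})$; - condition matrices $A_x=0$, $A_z=0$ and $A=\mathbf 0_{|\mathcal Z_\Delta|\times|\mathcal Z_\Delta|}\oplus I_{|\mathcal Z_\cap|+|\mathcal Z_S|}\oplus\mathbf 0_{|\mathcal Z_M|\times|\mathcal Z_M|}$, an $(n-k)\times(n-k)$ matrix. For every outcome vector $v_S\oplus v_M$ that can occur and every $m$, the circuits $\mathcal S_{\mathcal B}\circ\mathcal M_{\mathcal B}$ and $\mathcal C_{\mathrm{gen}}$ have the same action upon $v_S\oplus v_M$ and $m$ if and only if $$m=v_S(\mathcal Z_\Delta)\oplus v_S(\mathcal Z_\cap)\oplus v_S(\mathcal Z_S)\oplus v_M(\mathcal Z_M).$$ The outcomes $v_M((\mathcal X_\Delta)_j)$ are random and the action of $\mathcal S_{\mathcal B}\circ\mathcal M_{\mathcal B}$ does not depend on them. The outcomes $v_M((\mathcal Z_\cap)_j)$ are redundant and equal to $v_S((\mathcal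 Z_\cap)_j)$; conversely, every outcome vector with $v_M(\mathcal Z_\cap)=v_S(\mathcal Z_\cap)$ can occur. -/

import Mathlib

noncomputable section

namespace StabilizerCircuits

/-! ## Qubits, Pauli and Clifford unitaries -/

/-- Labels of the computational basis states of `n` qubits. -/
abbrev Bits (n : ℕ) : Type := Fin n → ZMod 2

/-- Linear maps from `m` qubits to `n` qubits, in the computational basis. -/
abbrev QMat (n m : ℕ) : Type := Matrix (Bits n) (Bits m) ℂ

/-- The group of `n`-qubit unitaries. -/
abbrev QUnitary (n : ℕ) := Matrix.unitaryGroup (Bits n) ℂ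

/-- The sign `(-1)^a` of a bit `a`. -/
def bitSign (a : ZMod 2) : ℂ := if a = 0 then 1 else -1

/-- The Pauli matrix `X`. -/
def sigmaX : Matrix (ZMod 2) (ZMod 2) ℂ := Matrix.of fun a b => if a = b then 0 else 1

/-- The Pauli matrix `Y`. -/
def sigmaY : Matrix (ZMod 2) (ZMod 2) ℂ :=
  Matrix.of fun a b => if a = b then 0 else if a = 0 then -Complex.I else Complex.I

/-- The Pauli matrix `Z`. -/
def sigmaZ : Matrix (ZMod 2) (ZMod 2) ℂ := Matrix.diagonal bitSign

/-- The Hadamard matrix `H`. -/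
def hadamard : Matrix (ZMod 2) (ZMod 2) ℂ :=
  Matrix.of fun a b => ((Real.sqrt 2 : ℝ) : ℂ)⁻¹ * bitSign (a * b)

/-- The tensor product `σ 0 ⊗ ⋯ ⊗ σ (n - 1)` of single-qubit operators. -/
def tensor {n : ℕ} (σ : Fin n → Matrix (ZMod 2) (ZMod 2) ℂ) : QMat n n :=
  Matrix.of fun a b => ∏ j, σ j (a j) (b j)

/-- The operator acting as `A` on qubit `j` and as the identity on the other qubits. -/
def onQubit {n : ℕ} (j : Fin n) (A : Matrix (ZMod 2) (ZMod 2) ℂ) : QMat n n :=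
  tensor (Function.update (fun _ => 1) j A)

/-- The standard Pauli operator `X_j`. -/
def stdX {n : ℕ} (j : Fin n) : QMat n n := onQubit j sigmaX

/-- The standard Pauli operator `Z_j`. -/
def stdZ {n : ℕ} (j : Fin n) : QMat n n := onQubit j sigmaZ

/-- The operator `H^{⊗ d} ⊗ I` on `n` qubits, with the Hadamards on the first `d` qubits. -/
def hadamardFirst (n d : ℕ) : QMat n n :=
  tensor fun j => if (j : ℕ) < d then hadamard else 1

/-- `P` is one of `I, X, Y, Z` on each qubit. -/
def IsPauliString {n : ℕ} (P : QMat n n) : Prop :=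
  ∃ σ : Fin n → Matrix (ZMod 2) (ZMod 2) ℂ,
    (∀ j, σ j = 1 ∨ σ j = sigmaX ∨ σ j = sigmaY ∨ σ j = sigmaZ) ∧ P = tensor σ

/-- Pauli unitaries: `i^r {I, X, Y, Z}^{⊗ n}`. -/
def IsPauli {n : ℕ} (P : QMat n n) : Prop :=
  ∃ (r : Fin 4) (Q : QMat n n), IsPauliString Q ∧ P = Complex.I ^ (r : ℕ) • Q

/-- Pauli observables: `± {I, X, Y, Z}^{⊗ n}`. -/
def IsPauliObservable {n : ℕ} (P : QMat n n) : Prop :=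
  ∃ Q : QMat n n, IsPauliString Q ∧ (P = Q ∨ P = -Q)

/-- Clifford unitaries: unitaries which map Pauli unitaries to Pauli unitaries by conjugation. -/
def IsClifford {n : ℕ} (C : QMat n n) : Prop :=
  C ∈ Matrix.unitaryGroup (Bits n) ℂ ∧
    ∀ P : QMat n n, IsPauli P → IsPauli (C * P * C.conjTranspose)

/-- A stabilizer group: a group of commuting Pauli observables which does not contain `-I`. -/
def IsStabilizerGroup {n : ℕ} (S : Subgroup (QUnitary n)) : Prop :=
  (∀ g ∈ S, IsPauliObservable (g : QMat n n)) ∧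
  (∀ g ∈ S, ∀ h ∈ S, g * h = h * g) ∧
  (∀ g ∈ S, (g : QMat n n) ≠ -1)

/-! ## Stabilizer circuits -/

/-- Circuits with a given number of input and output qubits.
* `alloc` allocates `n - m` qubits in the zero state, placed before the `m` existing qubits;
* `dealloc` deallocates the first `n - m` of `n` qubits;
* `randomBit` allocates a fair classical random bit;
* `measure P` is the non-destructive measurement of `P`;
* `condPauli P T` applies `P` if the parity of the outcomes with index in `T` is one.
Outcomes are numbered `0, 1, 2, …` in the order in which they occur. -/
inductive Circuit : ℕ → ℕ → Type
  | nil (n : ℕ) : Circuit n n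
  | seq {l m n : ℕ} (C : Circuit l m) (D : Circuit m n) : Circuit l n
  | alloc {m n : ℕ} (h : m ≤ n) : Circuit m n
  | dealloc {m n : ℕ} (h : m ≤ n) : Circuit n m
  | randomBit (n : ℕ) : Circuit n n
  | unitary {n : ℕ} (U : QMat n n) : Circuit n n
  | measure {n : ℕ} (P : QMat n n) : Circuit n n
  | condPauli {n : ℕ} (P : QMat n n) (T : Finset ℕ) : Circuit n n

/-- The isometry which adds `n - m` qubits in the zero state in front of `m` qubits. -/
def allocMat {m n : ℕ} (h : m ≤ n) : QMat n m :=
  Matrix.of fun a b =>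
    if (∀ i : Fin n, (i : ℕ) < n - m → a i = 0) ∧
      (∀ j : Fin m, a ⟨n - m + j, by omega⟩ = b j) then 1 else 0

namespace Circuit

/-- The length of the outcome vector (measurement outcomes and random bits) of a circuit. -/
def numOutcomes : {m n : ℕ} → Circuit m n → ℕ
  | _, _, nil _ => 0
  | _, _, seq C D => C.numOutcomes + D.numOutcomes
  | _, _, alloc _ => 0
  | _, _, dealloc _ => 0
  | _, _, randomBit _ => 1
  | _, _, unitary _ => 0
  | _, _, measure _ => 1
  | _, _, condPauli _ _ => 0

/-- The linear map enacted by a circuit when the outcomes are `v 0, v 1, …`. The circuit starts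
when `s` outcomes have already been recorded, so that its own outcomes are `v s, v (s + 1), …`;
a conditional Pauli only sees the outcomes recorded before it. -/
def kraus : {m n : ℕ} → Circuit m n → (s : ℕ) → (v : ℕ → ZMod 2) → QMat n m
  | _, _, nil _, _, _ => 1
  | _, _, seq C D, s, v => D.kraus (s + C.numOutcomes) v * C.kraus s v
  | _, _, alloc h, _, _ => allocMat h
  | _, _, dealloc h, _, _ => (allocMat h).conjTranspose
  | _, _, randomBit _, _, _ => ((Real.sqrt 2 : ℝ) : ℂ)⁻¹ • 1
  | _, _, unitary U, _, _ => U
  | _, _, measure P, s, v => (2 : ℂ)⁻¹ • (1 + bitSign (v s) • P)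
  | _, _, condPauli P T, s, v => if ∑ i ∈ T with i < s, v i = 1 then P else 1

/-- Shift the outcome indices that a circuit refers to by `s`. -/
def shift : {m n : ℕ} → Circuit m n → (s : ℕ) → Circuit m n
  | _, _, nil n, _ => nil n
  | _, _, seq C D, s => seq (C.shift s) (D.shift s)
  | _, _, alloc h, _ => alloc h
  | _, _, dealloc h, _ => dealloc h
  | _, _, randomBit n, _ => randomBit n
  | _, _, unitary U, _ => unitary U
  | _, _, measure P, _ => measure P
  | _, _, condPauli P T, s => condPauli P (T.map (addRightEmbedding s))

/-- The composition "first `C`, then `D`" of two self-contained circuits: the outcome vector is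
that of `C` followed by that of `D`, and the conditional Paulis of `D` refer to the outcomes
of `D`. -/
def andThen {l m n : ℕ} (C : Circuit l m) (D : Circuit m n) : Circuit l n :=
  seq C (D.shift C.numOutcomes)

/-- Extend an outcome vector by zeros. -/
def extend {N : ℕ} (v : Fin N → ZMod 2) (i : ℕ) : ZMod 2 := if h : i < N then v ⟨i, h⟩ else 0

/-- The linear map `Q_v` enacted by a circuit upon outcome vector `v`. -/
def linMap {m n : ℕ} (C : Circuit m n) (v : Fin C.numOutcomes → ZMod 2) : QMat n m :=
  C.kraus 0 (extend v)

/-- The completely positive map `ρ ↦ Q_v ρ Q_vᴴ` of a circuit upon outcome vector `v`. The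
instrument of the circuit is the family of the nonzero maps among these. -/
def action {m n : ℕ} (C : Circuit m n) (v : Fin C.numOutcomes → ZMod 2) :
    QMat m m →ₗ[ℂ] QMat n n where
  toFun ρ := C.linMap v * ρ * (C.linMap v).conjTranspose
  map_add' ρ σ := by rw [Matrix.mul_add, Matrix.add_mul]
  map_smul' a ρ := by simp

/-- All unitaries are Clifford, all measured operators are Pauli observables and all conditional
operators are Pauli unitaries. -/
def OpsValid : {m n : ℕ} → Circuit m n → Prop
  | _, _, nil _ => True
  | _, _, seq C D => C.OpsValid ∧ D.OpsValid
  | _, _, alloc _ => True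
  | _, _, dealloc _ => True
  | _, _, randomBit _ => True
  | _, _, unitary U => IsClifford U
  | _, _, measure P => IsPauliObservable P
  | _, _, condPauli P _ => IsPauli P

/-- Stabilizer circuits. The last condition (trace preservation) expresses that qubits are only
deallocated in the zero state: all operations except `dealloc` preserve the total probability,
and `dealloc` does so exactly for states whose deallocated qubits are all zero. -/
def IsStabilizerCircuit {m n : ℕ} (C : Circuit m n) : Prop :=
  C.OpsValid ∧ ∑ v, (C.linMap v).conjTranspose * C.linMap v = 1

/-- Non-destructive measurement of a list of operators, one after another. -/
def measureAll {n : ℕ} (l : List (QMat n n)) : Circuit n n :=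
  l.foldr (fun P C => seq (measure P) C) (nil n)

/-- Application of a list of conditional operators, one after another. -/
def condAll {n : ℕ} (l : List (QMat n n × Finset ℕ)) : Circuit n n :=
  l.foldr (fun p C => seq (condPauli p.1 p.2) C) (nil n)

/-- Allocation of `r` random bits. -/
def randomBits (n : ℕ) : (r : ℕ) → Circuit n n
  | 0 => nil n
  | r + 1 => seq (randomBit n) (randomBits n r)

@[simp] theorem numOutcomes_shift {m n : ℕ} (C : Circuit m n) (s : ℕ) :
    (C.shift s).numOutcomes = C.numOutcomes := by
  induction C <;> simp_all [shift, numOutcomes]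

@[simp] theorem numOutcomes_measureAll {n : ℕ} (l : List (QMat n n)) :
    (measureAll l).numOutcomes = l.length := by
  induction l with
  | nil => rfl
  | cons P l ih =>
    have h : (measureAll (P :: l)).numOutcomes = 1 + (measureAll l).numOutcomes := rfl
    rw [h, ih, List.length_cons, add_comm]

@[simp] theorem numOutcomes_condAll {n : ℕ} (l : List (QMat n n × Finset ℕ)) :
    (condAll l).numOutcomes = 0 := by
  induction l with
  | nil => rfl
  | cons P l ih =>
    have h : (condAll (P :: l)).numOutcomes = 0 + (condAll l).numOutcomes := rfl
    rw [h, ih]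

@[simp] theorem numOutcomes_randomBits (n r : ℕ) : (randomBits n r).numOutcomes = r := by
  induction r with
  | zero => rfl
  | succ r ih =>
    have h : (randomBits n (r + 1)).numOutcomes = 1 + (randomBits n r).numOutcomes := rfl
    rw [h, ih, add_comm]

end Circuit

/-! ## Equivalence of instruments -/

section Instrument

variable {R R' V : Type} [Fintype R] [Fintype R'] [AddCommGroup V] [Module ℂ V]

/-- Two outcomes with nonzero maps are grouped together if their maps are proportional. -/
def compressionSetoid (Q : R → V) : Setoid {r : R // Q r ≠ 0} where
  r a b := ∃ α : ℂ, Q a = α • Q b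
  iseqv :=
    { refl := fun a => ⟨1, (one_smul ℂ _).symm⟩
      symm := by
        rintro a b ⟨α, h⟩
        have hα : α ≠ 0 := by
          rintro rfl
          exact a.2 (by rw [h, zero_smul])
        exact ⟨α⁻¹, by rw [h, smul_smul, inv_mul_cancel₀ hα, one_smul]⟩
      trans := by
        rintro a b c ⟨α, h⟩ ⟨β, h'⟩
        exact ⟨α * β, by rw [h, h', smul_smul]⟩ }

/-- The outcomes of an instrument after compression. -/
abbrev CompressedOutcome (Q : R → V) : Type := Quotient (compressionSetoid Q)

open Classical in
/-- The maps of an instrument after compression: the sum of the maps in each group. -/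
def compressed (Q : R → V) (s : CompressedOutcome Q) : V :=
  ∑ r : {r : R // Q r ≠ 0} with Quotient.mk (compressionSetoid Q) r = s, Q r

/-- Two instruments (families of maps, of which the zero maps are discarded) are equivalent if
they agree after compression, up to a relabelling of the outcomes. -/
def InstrumentEquivalent (Q : R → V) (Q' : R' → V) : Prop :=
  ∃ f : CompressedOutcome Q ≃ CompressedOutcome Q', ∀ s, compressed Q s = compressed Q' (f s)

end Instrument

/-- Two circuits are equivalent if their instruments are. -/
def Circuit.Equivalent {m n : ℕ} (C D : Circuit m n) : Prop :=
  InstrumentEquivalent C.action D.action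

/-- Circuit `C` upon outcome `v` has the same action as circuit `D` upon outcome `w`: both
outcomes can occur, and the maps agree up to a positive factor (the output states agree for each
input, and the probabilities are proportional). -/
def SameAction {m n : ℕ} (C D : Circuit m n)
    (v : Fin C.numOutcomes → ZMod 2) (w : Fin D.numOutcomes → ZMod 2) : Prop :=
  C.action v ≠ 0 ∧ D.action w ≠ 0 ∧ ∃ α : ℝ, 0 < α ∧ C.action v = (α : ℂ) • D.action w

/-! ## Kinds of outcomes -/

open scoped ComplexOrder in
/-- Density matrices. -/
def IsDensity {m : ℕ} (ρ : QMat m m) : Prop := ρ.PosSemidef ∧ ρ.trace = 1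

namespace Circuit

variable {m n : ℕ} (C : Circuit m n)

/-- The probability of the outcome vector `v` on input `ρ`. -/
def prob (ρ : QMat m m) (v : Fin C.numOutcomes → ZMod 2) : ℝ := (C.action v ρ).trace.re

/-- The probability that the outcomes before outcome `i` agree with those of `v`. -/
def probPrefix (ρ : QMat m m) (i : Fin C.numOutcomes) (v : Fin C.numOutcomes → ZMod 2) : ℝ :=
  ∑ u : Fin C.numOutcomes → ZMod 2 with ∀ j < i, u j = v j, C.prob ρ u

/-- The probability that outcome `i` is zero, conditioned on the previous outcomes being as
in `v`. -/
def condProbZero (ρ : QMat m m) (i : Fin C.numOutcomes) (v : Fin C.numOutcomes → ZMod 2) : ℝ :=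
  (∑ u : Fin C.numOutcomes → ZMod 2 with (∀ j < i, u j = v j) ∧ u i = 0, C.prob ρ u) /
    C.probPrefix ρ i v

/-- Outcome `i` is random: whatever the input and the previous outcomes, it is zero with
probability `1 / 2`. -/
def IsRandomOutcome (i : Fin C.numOutcomes) : Prop :=
  ∀ v, ∀ ρ, IsDensity ρ → C.probPrefix ρ i v ≠ 0 → C.condProbZero ρ i v = 1 / 2

/-- Outcome `i` is redundant: for each sequence of previous outcomes, either it is zero with
probability zero for all inputs, or it is zero with probability one for all inputs. -/
def IsRedundantOutcome (i : Fin C.numOutcomes) : Prop :=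
  ∀ v,
    (∀ ρ, IsDensity ρ → C.probPrefix ρ i v ≠ 0 → C.condProbZero ρ i v = 0) ∨
    (∀ ρ, IsDensity ρ → C.probPrefix ρ i v ≠ 0 → C.condProbZero ρ i v = 1)

end Circuit

/-! ## General form circuits -/

/-- The parameters of a general form circuit with `nI` input and `nO` output qubits: the number
`k` of inner qubits, the number `nr` of random bits, the left and right unitaries `L` and `R` and
the condition matrices `A`, `Ax`, `Az`. -/
structure GeneralForm (nI nO : ℕ) where
  k : ℕ
  nr : ℕ
  k_le_nI : k ≤ nI
  k_le_nO : k ≤ nO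
  L : QMat nI nI
  R : QMat nO nO
  A : Matrix (Fin (nO - k)) (Fin (nr + (nI - k))) (ZMod 2)
  Ax : Matrix (Fin k) (Fin (nr + (nI - k))) (ZMod 2)
  Az : Matrix (Fin k) (Fin (nr + (nI - k))) (ZMod 2)

namespace GeneralForm

variable {nI nO : ℕ} (G : GeneralForm nI nO)

/-- The set of the outcomes whose parity is the product of a row of a condition matrix with the
outcome vector. -/
def rowSet {N : ℕ} (a : Fin N → ZMod 2) : Finset ℕ :=
  (Finset.univ.filter fun i => a i = 1).map Fin.valEmbedding

/-- The general form circuit. The random bits `r` are drawn; the inverse of `L` is applied; the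
first `nI - k` qubits are measured destructively in the `Z` basis, with outcome `m`; with
`o = r ⊕ m`, the Pauli operator `Z^(Az o) X^(Ax o)` is applied to the `k` remaining qubits;
`nO - k` qubits in the state `|A o⟩` are placed in front of these; and `R` is applied. -/
def circuit : Circuit nI nO :=
  .seq (Circuit.randomBits nI G.nr) <|
  .seq (.unitary G.L.conjTranspose) <|
  .seq (Circuit.measureAll
    (List.ofFn fun j : Fin (nI - G.k) => stdZ (n := nI) ⟨j, by omega⟩)) <|
  .seq (Circuit.condAll
    (List.ofFn fun j : Fin (nI - G.k) => (stdX (n := nI) ⟨j, by omega⟩, {G.nr + (j : ℕ)}))) <|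
  .seq (.dealloc G.k_le_nI) <|
  .seq (Circuit.condAll (List.ofFn fun j : Fin G.k => (stdX j, rowSet (G.Ax j)))) <|
  .seq (Circuit.condAll (List.ofFn fun j : Fin G.k => (stdZ j, rowSet (G.Az j)))) <|
  .seq (.alloc G.k_le_nO) <|
  .seq (Circuit.condAll
    (List.ofFn fun j : Fin (nO - G.k) => (stdX (n := nO) ⟨j, by omega⟩, rowSet (G.A j)))) <|
  .unitary G.R

theorem numOutcomes_circuit : G.circuit.numOutcomes = G.nr + (nI - G.k) := by
  simp [circuit, Circuit.numOutcomes]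

/-- The position in the outcome vector of the outcome `m_j` of measuring qubit `j`. -/
def posM (j : Fin (nI - G.k)) : Fin G.circuit.numOutcomes :=
  ⟨G.nr + j, by rw [numOutcomes_circuit]; omega⟩

end GeneralForm

/-! ## Common symplectic bases and the circuits they define -/

/-- The operators `z 0, …, z (n - 1), x 0, …, x (n - 1)` have the same commutation relations
as `Z_0, …, Z_(n - 1), X_0, …, X_(n - 1)`. -/
def IsSymplectic {n : ℕ} (z x : Fin n → QUnitary n) : Prop :=
  (∀ i j, z i * z j = z j * z i) ∧ (∀ i j, x i * x j = x j * x i) ∧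
  (∀ i j, i ≠ j → z i * x j = x j * z i) ∧
  (∀ i, (z i * x i : QMat n n) = -(x i * z i : QMat n n))

/-- A symplectic basis of `n`-qubit Pauli observables, grouped into ten ordered sets: `z` is the
concatenation of `zDelta`, `zCap`, `zS`, `zM`, `zL` and `x` is the concatenation of `xDelta`,
`xCap`, `xS`, `xM`, `xL`, the blocks having sizes `nDelta`, `nCap`, `nS`, `nM`, `nL`. -/
structure GroupedSymplecticBasis (n : ℕ) where
  nDelta : ℕ
  nCap : ℕ
  nS : ℕ
  nM : ℕ
  nL : ℕ
  size_eq : nDelta + nCap + nS + nM + nL = n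
  z : Fin n → QUnitary n
  x : Fin n → QUnitary n
  z_obs : ∀ i, IsPauliObservable (z i : QMat n n)
  x_obs : ∀ i, IsPauliObservable (x i : QMat n n)
  symplectic : IsSymplectic z x

namespace GroupedSymplecticBasis

variable {n : ℕ} (B : GroupedSymplecticBasis n)

/-- The qubit at position `j` of the first block. -/
def iDelta (j : Fin B.nDelta) : Fin n := ⟨j, by have := B.size_eq; omega⟩

/-- The qubit at position `j` of the second block. -/
def iCap (j : Fin B.nCap) : Fin n := ⟨B.nDelta + j, by have := B.size_eq; omega⟩

/-- The qubit at position `j` of the third block. -/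
def iS (j : Fin B.nS) : Fin n := ⟨B.nDelta + B.nCap + j, by have := B.size_eq; omega⟩

/-- The qubit at position `j` of the fourth block. -/
def iM (j : Fin B.nM) : Fin n := ⟨B.nDelta + B.nCap + B.nS + j, by have := B.size_eq; omega⟩

/-- The qubit at position `j` of the fifth block. -/
def iL (j : Fin B.nL) : Fin n :=
  ⟨B.nDelta + B.nCap + B.nS + B.nM + j, by have := B.size_eq; omega⟩

def zDelta (j : Fin B.nDelta) : QUnitary n := B.z (B.iDelta j)
def xDelta (j : Fin B.nDelta) : QUnitary n := B.x (B.iDelta j)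
def zCap (j : Fin B.nCap) : QUnitary n := B.z (B.iCap j)
def xCap (j : Fin B.nCap) : QUnitary n := B.x (B.iCap j)
def zS (j : Fin B.nS) : QUnitary n := B.z (B.iS j)
def xS (j : Fin B.nS) : QUnitary n := B.x (B.iS j)
def zM (j : Fin B.nM) : QUnitary n := B.z (B.iM j)
def xM (j : Fin B.nM) : QUnitary n := B.x (B.iM j)
def zL (j : Fin B.nL) : QUnitary n := B.z (B.iL j)
def xL (j : Fin B.nL) : QUnitary n := B.x (B.iL j)

/-- `B` is a common symplectic basis of the groups `S` and `M`. -/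
def IsCommonBasis (S M : Subgroup (QUnitary n)) : Prop :=
  S = Subgroup.closure (Set.range B.zDelta ∪ Set.range B.zCap ∪ Set.range B.zS) ∧
  M = Subgroup.closure (Set.range B.xDelta ∪ Set.range B.zCap ∪ Set.range B.zM)

/-- The syndrome extraction circuit: measure `zDelta`, `zCap`, `zS`. -/
def syndromeCircuit : Circuit n n :=
  Circuit.measureAll
    (List.ofFn (fun j => (B.zDelta j : QMat n n)) ++ List.ofFn (fun j => (B.zCap j : QMat n n)) ++
      List.ofFn (fun j => (B.zS j : QMat n n)))

/-- The code deformation circuit: measure `xDelta`, `zCap`, `zM`; then apply each `zDelta j`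
conditioned on the outcome of `xDelta j` being one, and each `xM j` conditioned on the outcome of
`zM j` being one. -/
def deformationCircuit : Circuit n n :=
  .seq (Circuit.measureAll
    (List.ofFn (fun j => (B.xDelta j : QMat n n)) ++ List.ofFn (fun j => (B.zCap j : QMat n n)) ++
      List.ofFn (fun j => (B.zM j : QMat n n)))) <|
  .seq (Circuit.condAll
    (List.ofFn fun j : Fin B.nDelta => ((B.zDelta j : QMat n n), {(j : ℕ)})))
  (Circuit.condAll
    (List.ofFn fun j : Fin B.nM => ((B.xM j : QMat n n), {B.nDelta + B.nCap + (j : ℕ)})))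

/-- First the syndrome extraction circuit, then the code deformation circuit. The outcome vector
is `v_S ⊕ v_M`. -/
def twoGroupCircuit : Circuit n n := B.syndromeCircuit.andThen B.deformationCircuit

theorem numOutcomes_syndromeCircuit :
    B.syndromeCircuit.numOutcomes = B.nDelta + B.nCap + B.nS := by
  simp [syndromeCircuit, add_assoc]

theorem numOutcomes_deformationCircuit :
    B.deformationCircuit.numOutcomes = B.nDelta + B.nCap + B.nM := by
  simp [deformationCircuit, Circuit.numOutcomes, add_assoc]

theorem numOutcomes_twoGroupCircuit :
    B.twoGroupCircuit.numOutcomes =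
      (B.nDelta + B.nCap + B.nS) + (B.nDelta + B.nCap + B.nM) := by
  simp [twoGroupCircuit, Circuit.andThen, Circuit.numOutcomes, numOutcomes_syndromeCircuit,
    numOutcomes_deformationCircuit]

/-- The position of `v_S(zDelta j)` in the outcome vector. -/
def posSDelta (j : Fin B.nDelta) : Fin B.twoGroupCircuit.numOutcomes :=
  ⟨j, by rw [numOutcomes_twoGroupCircuit]; omega⟩

/-- The position of `v_S(zCap j)` in the outcome vector. -/
def posSCap (j : Fin B.nCap) : Fin B.twoGroupCircuit.numOutcomes :=
  ⟨B.nDelta + j, by rw [numOutcomes_twoGroupCircuit]; omega⟩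

/-- The position of `v_S(zS j)` in the outcome vector. -/
def posSS (j : Fin B.nS) : Fin B.twoGroupCircuit.numOutcomes :=
  ⟨B.nDelta + B.nCap + j, by rw [numOutcomes_twoGroupCircuit]; omega⟩

/-- The position of `v_M(xDelta j)` in the outcome vector. -/
def posMDelta (j : Fin B.nDelta) : Fin B.twoGroupCircuit.numOutcomes :=
  ⟨(B.nDelta + B.nCap + B.nS) + j, by rw [numOutcomes_twoGroupCircuit]; omega⟩

/-- The position of `v_M(zCap j)` in the outcome vector. -/
def posMCap (j : Fin B.nCap) : Fin B.twoGroupCircuit.numOutcomes :=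
  ⟨(B.nDelta + B.nCap + B.nS) + (B.nDelta + j), by rw [numOutcomes_twoGroupCircuit]; omega⟩

/-- The position of `v_M(zM j)` in the outcome vector. -/
def posMM (j : Fin B.nM) : Fin B.twoGroupCircuit.numOutcomes :=
  ⟨(B.nDelta + B.nCap + B.nS) + (B.nDelta + B.nCap + j), by
    rw [numOutcomes_twoGroupCircuit]; omega⟩

/-- `C` is a Clifford unitary which maps the standard Pauli basis to `B`. -/
def IsBasisClifford (C : QMat n n) : Prop :=
  IsClifford C ∧ (∀ i, C * stdZ i * C.conjTranspose = (B.z i : QMat n n)) ∧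
    (∀ i, C * stdX i * C.conjTranspose = (B.x i : QMat n n))

/-- The general form circuit with `nL` inner qubits, no random bits, left unitary `C`, right
unitary `C (H^{⊗ nDelta} ⊗ I)`, condition matrix `A = 0 ⊕ I ⊕ 0` with blocks of sizes `nDelta`,
`nCap + nS` and `nM`, and zero condition matrices `Ax` and `Az`. -/
def generalForm (C : QMat n n) : GeneralForm n n where
  k := B.nL
  nr := 0
  k_le_nI := by have := B.size_eq; omega
  k_le_nO := by have := B.size_eq; omega
  L := C
  R := C * hadamardFirst n B.nDelta
  A := Matrix.of fun i j =>
    if (i : ℕ) = j ∧ B.nDelta ≤ (i : ℕ) ∧ (i : ℕ) < B.nDelta + (B.nCap + B.nS) then 1 else 0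
  Ax := 0
  Az := 0

/-- The outcome relation `m = v_S(zDelta) ⊕ v_S(zCap) ⊕ v_S(zS) ⊕ v_M(zM)`. -/
def OutcomeRelation (C : QMat n n) (v : Fin B.twoGroupCircuit.numOutcomes → ZMod 2)
    (m : Fin (B.generalForm C).circuit.numOutcomes → ZMod 2) : Prop :=
  ∀ i : Fin (n - B.nL),
    (∀ j : Fin B.nDelta, (i : ℕ) = j →
      m ((B.generalForm C).posM i) = v (B.posSDelta j)) ∧
    (∀ j : Fin B.nCap, (i : ℕ) = B.nDelta + j →
      m ((B.generalForm C).posM i) = v (B.posSCap j)) ∧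
    (∀ j : Fin B.nS, (i : ℕ) = B.nDelta + B.nCap + j →
      m ((B.generalForm C).posM i) = v (B.posSS j)) ∧
    (∀ j : Fin B.nM, (i : ℕ) = B.nDelta + B.nCap + B.nS + j →
      m ((B.generalForm C).posM i) = v (B.posMM j))

end GroupedSymplecticBasis

end StabilizerCircuits

end

open StabilizerCircuits

namespace StabilizerCircuits

open Matrix

/-! ## Single-qubit matrices -/

/-! Conjugation by `C` turns each basis operator into a Pauli operator on a single qubit. Every
Kraus operator of either circuit is therefore `C * T * Cᴴ` with `T` a tensor product, and the
circuits can be compared one qubit at a time. Write a for the outcome of a qubit in the syndrome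
part and b for its outcome in the deformation part. The factors of the two-group circuit are as
follows: Δ: Z^b P_X(b) |a⟩⟨a| = 2^(-1/2) (-1)^(ab) H|0⟩⟨a|; ∩: |b⟩⟨b|a⟩⟨a|, which is |a⟩⟨a| if a = b
and 0 otherwise; S: |a⟩⟨a|; M: X^b |b⟩⟨b| = |0⟩⟨b|; the inner qubits: the identity. Up to the
scalars these are the factors of the general form circuit at the matching outcome m
(`kraus_twoGroupCircuit`, `kraus_generalForm`). Passing from Q to ρ ↦ QρQᴴ replaces the scalar by
its squared modulus. So the action upon v is 2^(-nDelta) times the general form action upon m if the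
two measurements of each `zCap` agree, and zero otherwise (`action_twoGroupCircuit`).

The general form operators have Gram operators QᴴQ that are mutually orthogonal projectors with sum
1. Their actions are thus nonzero and pairwise non-proportional (`eq_of_action_generalForm`). Each m
comes from exactly 2^nDelta consistent vectors v, one for each choice of the `xDelta` outcomes
(`sum_consistent`), which cancels the weight 2^(-nDelta). Equivalence, the outcome relation,
randomness and redundancy all follow from these facts.

For the existence of `C`, the commuting operators `z i` have a common fixed unit vector ψ, since `x
i` flips the sign of `z i` and leaves the others alone. Sending the basis vector |a⟩ to ∏ (x i)^(a
i) ψ gives an orthonormal basis, and the resulting unitary intertwines the two Pauli bases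
(`exists_isBasisClifford`). -/

theorem bit_cases (a : ZMod 2) : a = 0 ∨ a = 1 := by revert a; decide

theorem sum_bit {V : Type*} [AddCommMonoid V] (f : ZMod 2 → V) : ∑ a, f a = f 0 + f 1 :=
  Fin.sum_univ_two f

theorem qubit_ext {A B : Matrix (ZMod 2) (ZMod 2) ℂ} (h00 : A 0 0 = B 0 0) (h01 : A 0 1 = B 0 1)
    (h10 : A 1 0 = B 1 0) (h11 : A 1 1 = B 1 1) : A = B := by
  ext i j
  rcases bit_cases i with rfl | rfl <;> rcases bit_cases j with rfl | rfl <;> assumption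

@[simp] theorem bitSign_zero : bitSign 0 = 1 := by simp [bitSign]

@[simp] theorem bitSign_one : bitSign 1 = -1 := by simp [bitSign]

theorem bitSign_mul_self (a : ZMod 2) : bitSign a * bitSign a = 1 := by
  rcases bit_cases a with rfl | rfl <;> simp

theorem sqrt_two_inv_mul_self :
    ((Real.sqrt 2 : ℝ) : ℂ)⁻¹ * ((Real.sqrt 2 : ℝ) : ℂ)⁻¹ = 2⁻¹ := by
  rw [← mul_inv, ← Complex.ofReal_mul, Real.mul_self_sqrt (by norm_num)]; norm_num

theorem sigmaX_mul_sigmaX : sigmaX * sigmaX = 1 := by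
  apply qubit_ext <;> simp [Matrix.mul_apply, sum_bit, sigmaX]

theorem sigmaY_mul_sigmaY : sigmaY * sigmaY = 1 := by
  apply qubit_ext <;> simp [Matrix.mul_apply, sum_bit, sigmaY]

theorem sigmaZ_mul_sigmaZ : sigmaZ * sigmaZ = 1 := by
  apply qubit_ext <;> simp [Matrix.mul_apply, sum_bit, sigmaZ]

theorem sigmaX_mul_sigmaY : sigmaX * sigmaY = Complex.I ^ 1 • sigmaZ := by
  apply qubit_ext <;> simp [Matrix.mul_apply, sum_bit, sigmaX, sigmaY, sigmaZ]

theorem sigmaY_mul_sigmaX : sigmaY * sigmaX = Complex.I ^ 3 • sigmaZ := by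
  apply qubit_ext <;> simp [Matrix.mul_apply, sum_bit, sigmaX, sigmaY, sigmaZ]

theorem sigmaX_mul_sigmaZ : sigmaX * sigmaZ = Complex.I ^ 3 • sigmaY := by
  apply qubit_ext <;> simp [Matrix.mul_apply, sum_bit, sigmaX, sigmaY, sigmaZ]

theorem sigmaZ_mul_sigmaX : sigmaZ * sigmaX = Complex.I ^ 1 • sigmaY := by
  apply qubit_ext <;> simp [Matrix.mul_apply, sum_bit, sigmaX, sigmaY, sigmaZ]

theorem sigmaY_mul_sigmaZ : sigmaY * sigmaZ = Complex.I ^ 1 • sigmaX := by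
  apply qubit_ext <;> simp [Matrix.mul_apply, sum_bit, sigmaX, sigmaY, sigmaZ]

theorem sigmaZ_mul_sigmaY : sigmaZ * sigmaY = Complex.I ^ 3 • sigmaX := by
  apply qubit_ext <;> simp [Matrix.mul_apply, sum_bit, sigmaX, sigmaY, sigmaZ]

theorem conjTranspose_sigmaX : sigmaXᴴ = sigmaX := by
  apply qubit_ext <;> simp [sigmaX]

theorem conjTranspose_sigmaY : sigmaYᴴ = sigmaY := by
  apply qubit_ext <;> simp [sigmaY]

theorem conjTranspose_sigmaZ : sigmaZᴴ = sigmaZ := by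
  apply qubit_ext <;> simp [sigmaZ]

theorem conjTranspose_hadamard : hadamardᴴ = hadamard := by
  apply qubit_ext <;> simp [hadamard]

theorem hadamard_mul_hadamard : hadamard * hadamard = 1 := by
  have := sqrt_two_inv_mul_self
  apply qubit_ext <;> simp [Matrix.mul_apply, sum_bit, hadamard, this]
  all_goals norm_num

theorem hadamard_mul_sigmaX : hadamard * sigmaX = sigmaZ * hadamard := by
  apply qubit_ext <;> simp [Matrix.mul_apply, sum_bit, hadamard, sigmaX, sigmaZ]

theorem hadamard_mul_sigmaZ : hadamard * sigmaZ = sigmaX * hadamard := by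
  apply qubit_ext <;> simp [Matrix.mul_apply, sum_bit, hadamard, sigmaX, sigmaZ]

theorem hadamard_mul_sigmaY : hadamard * sigmaY = (Complex.I ^ 2 • sigmaY) * hadamard := by
  apply qubit_ext <;> simp [Matrix.mul_apply, sum_bit, hadamard, sigmaY]
  all_goals ring

/-- `A` is one of the single-qubit matrices `I, X, Y, Z`. -/
def IsPauliMatrix (A : Matrix (ZMod 2) (ZMod 2) ℂ) : Prop :=
  A = 1 ∨ A = sigmaX ∨ A = sigmaY ∨ A = sigmaZ

theorem IsPauliMatrix.one : IsPauliMatrix 1 := Or.inl rfl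

theorem IsPauliMatrix.sigmaX : IsPauliMatrix sigmaX := Or.inr (Or.inl rfl)

theorem IsPauliMatrix.sigmaY : IsPauliMatrix sigmaY := Or.inr (Or.inr (Or.inl rfl))

theorem IsPauliMatrix.sigmaZ : IsPauliMatrix sigmaZ := Or.inr (Or.inr (Or.inr rfl))

theorem IsPauliMatrix.mul {A B : Matrix (ZMod 2) (ZMod 2) ℂ} (hA : IsPauliMatrix A)
    (hB : IsPauliMatrix B) : ∃ (r : ℕ) (D : _), IsPauliMatrix D ∧ A * B = Complex.I ^ r • D := by
  rcases hA with rfl | rfl | rfl | rfl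
  · exact ⟨0, B, hB, by simp⟩
  all_goals rcases hB with rfl | rfl | rfl | rfl
  · exact ⟨0, _, .sigmaX, by simp⟩
  · exact ⟨0, _, .one, by simp [sigmaX_mul_sigmaX]⟩
  · exact ⟨1, _, .sigmaZ, sigmaX_mul_sigmaY⟩
  · exact ⟨3, _, .sigmaY, sigmaX_mul_sigmaZ⟩
  · exact ⟨0, _, .sigmaY, by simp⟩
  · exact ⟨3, _, .sigmaZ, sigmaY_mul_sigmaX⟩
  · exact ⟨0, _, .one, by simp [sigmaY_mul_sigmaY]⟩
  · exact ⟨1, _, .sigmaX, sigmaY_mul_sigmaZ⟩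
  · exact ⟨0, _, .sigmaZ, by simp⟩
  · exact ⟨1, _, .sigmaY, sigmaZ_mul_sigmaX⟩
  · exact ⟨3, _, .sigmaX, sigmaZ_mul_sigmaY⟩
  · exact ⟨0, _, .one, by simp [sigmaZ_mul_sigmaZ]⟩

theorem IsPauliMatrix.mul_self {A : Matrix (ZMod 2) (ZMod 2) ℂ} (hA : IsPauliMatrix A) :
    A * A = 1 := by
  rcases hA with rfl | rfl | rfl | rfl
  exacts [one_mul 1, sigmaX_mul_sigmaX, sigmaY_mul_sigmaY, sigmaZ_mul_sigmaZ]

theorem IsPauliMatrix.conjTranspose {A : Matrix (ZMod 2) (ZMod 2) ℂ} (hA : IsPauliMatrix A) :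
    Aᴴ = A := by
  rcases hA with rfl | rfl | rfl | rfl
  exacts [Matrix.conjTranspose_one, conjTranspose_sigmaX, conjTranspose_sigmaY,
    conjTranspose_sigmaZ]

theorem IsPauliMatrix.hadamard_conj {A : Matrix (ZMod 2) (ZMod 2) ℂ} (hA : IsPauliMatrix A) :
    ∃ (r : ℕ) (D : _), IsPauliMatrix D ∧ hadamard * A * hadamardᴴ = Complex.I ^ r • D := by
  rw [conjTranspose_hadamard]
  rcases hA with rfl | rfl | rfl | rfl
  · exact ⟨0, _, .one, by simp [hadamard_mul_hadamard]⟩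
  · exact ⟨0, _, .sigmaZ, by
      rw [hadamard_mul_sigmaX, Matrix.mul_assoc, hadamard_mul_hadamard]; simp⟩
  · exact ⟨2, _, .sigmaY, by
      rw [hadamard_mul_sigmaY, Matrix.mul_assoc, hadamard_mul_hadamard, Matrix.mul_one]⟩
  · exact ⟨0, _, .sigmaX, by
      rw [hadamard_mul_sigmaZ, Matrix.mul_assoc, hadamard_mul_hadamard]; simp⟩

/-! ## Tensor products of single-qubit matrices -/

section Tensor

variable {n : ℕ}

/-- A product over qubits of sums over one bit expands into a sum over bit strings. This is the
identity that reduces circuits to single-qubit computations. -/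
theorem tensor_mul (σ τ : Fin n → Matrix (ZMod 2) (ZMod 2) ℂ) :
    tensor σ * tensor τ = tensor fun j => σ j * τ j := by
  ext a b
  simp only [tensor, Matrix.mul_apply, Matrix.of_apply, ← Finset.prod_mul_distrib]
  rw [Finset.prod_univ_sum, Fintype.piFinset_univ]

theorem tensor_one : tensor (fun _ : Fin n => (1 : Matrix (ZMod 2) (ZMod 2) ℂ)) = 1 := by
  ext a b
  simp only [tensor, Matrix.of_apply, Matrix.one_apply, Finset.prod_ite_zero,
    Finset.prod_const_one, funext_iff]
  simp

theorem tensor_smul (c : Fin n → ℂ) (σ : Fin n → Matrix (ZMod 2) (ZMod 2) ℂ) :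
    tensor (fun j => c j • σ j) = (∏ j, c j) • tensor σ := by
  ext a b
  simp [tensor, Finset.prod_mul_distrib]

theorem conjTranspose_tensor (σ : Fin n → Matrix (ZMod 2) (ZMod 2) ℂ) :
    (tensor σ)ᴴ = tensor fun j => (σ j)ᴴ := by
  ext a b
  simp [tensor, Matrix.conjTranspose_apply]

theorem tensor_eq_zero {σ : Fin n → Matrix (ZMod 2) (ZMod 2) ℂ} (j : Fin n) (h : σ j = 0) :
    tensor σ = 0 := by
  ext a b
  exact Finset.prod_eq_zero (Finset.mem_univ j) (by simp [h])

theorem onQubit_mul (j : Fin n) (A B : Matrix (ZMod 2) (ZMod 2) ℂ) :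
    onQubit j A * onQubit j B = onQubit j (A * B) := by
  rw [onQubit, onQubit, tensor_mul, onQubit]
  congr 1
  ext1 i
  by_cases h : i = j
  · subst h; simp
  · simp [h]

@[simp] theorem onQubit_one (j : Fin n) : onQubit j 1 = 1 := by
  rw [onQubit, show Function.update (fun _ : Fin n => (1 : Matrix (ZMod 2) (ZMod 2) ℂ)) j 1 =
    fun _ => 1 from Function.update_eq_self j _, tensor_one]

theorem onQubit_smul (j : Fin n) (c : ℂ) (A : Matrix (ZMod 2) (ZMod 2) ℂ) :
    onQubit j (c • A) = c • onQubit j A := by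
  have h : (Function.update (fun _ => 1) j (c • A) : Fin n → Matrix (ZMod 2) (ZMod 2) ℂ) =
      fun i => (Function.update (fun _ => (1 : ℂ)) j c i) •
        (Function.update (fun _ => 1) j A : Fin n → Matrix (ZMod 2) (ZMod 2) ℂ) i := by
    ext1 i
    by_cases h : i = j
    · subst h; simp
    · simp [h]
  rw [onQubit, h, tensor_smul, onQubit, Finset.prod_update_of_mem (Finset.mem_univ j)]
  simp

/-- Each matrix entry is an entry of the operator on qubit `j` times a factor that does not involve
this operator. -/
theorem onQubit_add (j : Fin n) (A B : Matrix (ZMod 2) (ZMod 2) ℂ) :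
    onQubit j (A + B) = onQubit j A + onQubit j B := by
  ext a b
  have key : ∀ D : Matrix (ZMod 2) (ZMod 2) ℂ, onQubit j D a b = D (a j) (b j) *
      ∏ i ∈ Finset.univ \ {j}, (1 : Matrix (ZMod 2) (ZMod 2) ℂ) (a i) (b i) := by
    intro D
    rw [onQubit, tensor, Matrix.of_apply,
      ← Finset.mul_prod_erase Finset.univ _ (Finset.mem_univ j), Function.update_self,
      Finset.sdiff_singleton_eq_erase]
    congr 1
    refine Finset.prod_congr rfl fun i hi => ?_
    rw [Function.update_of_ne (Finset.ne_of_mem_erase hi)]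
  rw [Matrix.add_apply, key, key, key, Matrix.add_apply, add_mul]

end Tensor

/-! ## The Pauli group and the Clifford group -/

section Pauli

variable {n : ℕ}

theorem isPauliString_tensor {σ : Fin n → Matrix (ZMod 2) (ZMod 2) ℂ}
    (h : ∀ j, IsPauliMatrix (σ j)) : IsPauliString (tensor σ) := ⟨σ, h, rfl⟩

theorem IsPauliString.isPauli_smul {Q : QMat n n} (h : IsPauliString Q) (r : ℕ) :
    IsPauli (Complex.I ^ r • Q) :=
  ⟨⟨r % 4, Nat.mod_lt _ (by norm_num)⟩, Q, h, by
    rw [Complex.I_pow_eq_pow_mod r]⟩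

theorem IsPauliString.isPauli {Q : QMat n n} (h : IsPauliString Q) : IsPauli Q := by
  simpa using h.isPauli_smul 0

/-- The phases produced on separate qubits multiply to a single power of i. -/
theorem isPauli_tensor_of_smul {σ : Fin n → Matrix (ZMod 2) (ZMod 2) ℂ}
    (h : ∀ j, ∃ (r : ℕ) (D : _), IsPauliMatrix D ∧ σ j = Complex.I ^ r • D) :
    IsPauli (tensor σ) := by
  choose r D hD hσ using h
  rw [funext hσ, tensor_smul, Finset.prod_pow_eq_pow_sum]
  exact (isPauliString_tensor hD).isPauli_smul _

theorem IsPauli.smul_I_pow {P : QMat n n} (h : IsPauli P) (r : ℕ) :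
    IsPauli (Complex.I ^ r • P) := by
  obtain ⟨s, Q, hQ, rfl⟩ := h
  rw [smul_smul, ← pow_add]
  exact hQ.isPauli_smul _

theorem IsPauli.mul {P Q : QMat n n} (hP : IsPauli P) (hQ : IsPauli Q) : IsPauli (P * Q) := by
  obtain ⟨r, _, ⟨σ, hσ, rfl⟩, rfl⟩ := hP
  obtain ⟨s, _, ⟨τ, hτ, rfl⟩, rfl⟩ := hQ
  rw [Matrix.smul_mul, Matrix.mul_smul, tensor_mul]
  exact ((isPauli_tensor_of_smul fun j =>
    IsPauliMatrix.mul (hσ j) (hτ j)).smul_I_pow s).smul_I_pow r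

theorem IsPauliObservable.isPauli {P : QMat n n} (h : IsPauliObservable P) : IsPauli P := by
  obtain ⟨Q, hQ, rfl | rfl⟩ := h
  · exact hQ.isPauli
  · simpa using hQ.isPauli_smul 2

theorem IsPauliString.mul_self {Q : QMat n n} (h : IsPauliString Q) : Q * Q = 1 := by
  obtain ⟨σ, hσ, rfl⟩ := h
  rw [tensor_mul, funext fun j => IsPauliMatrix.mul_self (hσ j), tensor_one]

theorem IsPauliString.conjTranspose {Q : QMat n n} (h : IsPauliString Q) : Qᴴ = Q := by
  obtain ⟨σ, hσ, rfl⟩ := h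
  rw [conjTranspose_tensor, funext fun j => IsPauliMatrix.conjTranspose (hσ j)]

theorem IsPauliObservable.mul_self {P : QMat n n} (h : IsPauliObservable P) : P * P = 1 := by
  obtain ⟨Q, hQ, rfl | rfl⟩ := h <;> simp [hQ.mul_self]

theorem IsPauliObservable.conjTranspose {P : QMat n n} (h : IsPauliObservable P) : Pᴴ = P := by
  obtain ⟨Q, hQ, rfl | rfl⟩ := h <;> simp [hQ.conjTranspose]

theorem isPauliString_onQubit (j : Fin n) {A : Matrix (ZMod 2) (ZMod 2) ℂ}
    (hA : IsPauliMatrix A) : IsPauliString (onQubit j A) := by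
  refine isPauliString_tensor fun i => ?_
  by_cases h : i = j
  · subst h; simpa using hA
  · simpa [h] using IsPauliMatrix.one

theorem isPauliString_stdX (j : Fin n) : IsPauliString (stdX j) :=
  isPauliString_onQubit j .sigmaX

theorem isPauliString_stdZ (j : Fin n) : IsPauliString (stdZ j) :=
  isPauliString_onQubit j .sigmaZ

/-- Finiteness turns an injective self-map of the Pauli unitaries into a bijection, which is needed
to invert a Clifford unitary. -/
theorem finite_isPauli : {P : QMat n n | IsPauli P}.Finite := by
  have hfin : {A : Matrix (ZMod 2) (ZMod 2) ℂ | IsPauliMatrix A}.Finite :=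
    Set.Finite.subset (Set.toFinite {1, sigmaX, sigmaY, sigmaZ}) fun A hA => by
      simpa [IsPauliMatrix] using hA
  have hpi : (Set.univ.pi fun _ : Fin n => {A | IsPauliMatrix A}).Finite :=
    Set.Finite.pi fun _ => hfin
  refine (((Set.finite_univ (α := Fin 4)).prod hpi).image
    fun p => Complex.I ^ (p.1 : ℕ) • tensor p.2).subset ?_
  rintro _ ⟨r, _, ⟨σ, hσ, rfl⟩, rfl⟩
  exact ⟨(r, σ), ⟨Set.mem_univ _, fun j _ => hσ j⟩, rfl⟩

/-! ### Conjugation by Clifford unitaries. -/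

theorem conj_mul_conj {C : QMat n n} (h : Cᴴ * C = 1) (P Q : QMat n n) :
    (C * P * Cᴴ) * (C * Q * Cᴴ) = C * (P * Q) * Cᴴ := by
  calc (C * P * Cᴴ) * (C * Q * Cᴴ) = C * P * (Cᴴ * C) * Q * Cᴴ := by
        simp only [Matrix.mul_assoc]
    _ = C * (P * Q) * Cᴴ := by rw [h, Matrix.mul_one, Matrix.mul_assoc C P Q]

theorem IsClifford.conjTranspose_mul_self {C : QMat n n} (h : IsClifford C) : Cᴴ * C = 1 :=
  Matrix.mem_unitaryGroup_iff'.mp h.1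

theorem IsClifford.mul_conjTranspose_self {C : QMat n n} (h : IsClifford C) : C * Cᴴ = 1 :=
  Matrix.mem_unitaryGroup_iff.mp h.1

theorem IsClifford.mul {C D : QMat n n} (hC : IsClifford C) (hD : IsClifford D) :
    IsClifford (C * D) := by
  refine ⟨mul_mem hC.1 hD.1, fun P hP => ?_⟩
  have := hC.2 _ (hD.2 P hP)
  simpa only [Matrix.conjTranspose_mul, Matrix.mul_assoc] using this

/-- The definition only says that conjugation by `C` maps the Pauli unitaries into themselves. This
map is injective on a finite set, hence onto: each Pauli unitary is `C * Q * Cᴴ` with `Q` Pauli, and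
the inverse conjugation returns `Q`. -/
theorem IsClifford.conjTranspose {C : QMat n n} (hC : IsClifford C) : IsClifford Cᴴ := by
  have h₁ := hC.conjTranspose_mul_self
  refine ⟨Unitary.star_mem hC.1, fun P hP => ?_⟩
  have hinj : Set.InjOn (fun P : QMat n n => C * P * Cᴴ) {P | IsPauli P} := by
    intro P _ Q _ h
    have h' : Cᴴ * (C * P * Cᴴ) * C = Cᴴ * (C * Q * Cᴴ) * C := by
      simp only at h; rw [h]
    have key : ∀ R : QMat n n, Cᴴ * (C * R * Cᴴ) * C = R := fun R => by
      calc Cᴴ * (C * R * Cᴴ) * C = (Cᴴ * C) * R * (Cᴴ * C) := by simp only [Matrix.mul_assoc]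
        _ = R := by rw [h₁, Matrix.one_mul, Matrix.mul_one]
    rwa [key, key] at h'
  have himage : (fun P : QMat n n => C * P * Cᴴ) '' {P | IsPauli P} ⊆ {P | IsPauli P} := by
    rintro _ ⟨P, hP, rfl⟩
    exact hC.2 P hP
  have hsurj := Set.eq_of_subset_of_ncard_le himage hinj.ncard_image.ge finite_isPauli
  obtain ⟨Q, hQ, rfl⟩ := hsurj.ge hP
  have : Cᴴ * (C * Q * Cᴴ) * Cᴴᴴ = (Cᴴ * C) * Q * (Cᴴ * C) := by
    simp only [Matrix.mul_assoc, Matrix.conjTranspose_conjTranspose]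
  simp only [this, h₁, Matrix.one_mul, Matrix.mul_one]
  exact hQ

theorem isClifford_hadamardFirst (n d : ℕ) : IsClifford (hadamardFirst n d) := by
  constructor
  · rw [Matrix.mem_unitaryGroup_iff, Matrix.star_eq_conjTranspose, hadamardFirst,
      conjTranspose_tensor, tensor_mul, ← tensor_one]
    congr 1
    ext1 j
    split_ifs
    · rw [conjTranspose_hadamard, hadamard_mul_hadamard]
    · simp
  · rintro _ ⟨r, _, ⟨σ, hσ, rfl⟩, rfl⟩
    rw [hadamardFirst, conjTranspose_tensor, Matrix.mul_smul, Matrix.smul_mul, tensor_mul,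
      tensor_mul]
    refine (isPauli_tensor_of_smul fun j => ?_).smul_I_pow r
    split_ifs
    · exact IsPauliMatrix.hadamard_conj (hσ j)
    · exact ⟨0, σ j, hσ j, by simp⟩

/-- A unitary which maps the generators of the Pauli group to Pauli unitaries is Clifford. -/
theorem isClifford_of_generators {C : QMat n n} (hC : C ∈ Matrix.unitaryGroup (Bits n) ℂ)
    (hX : ∀ j, IsPauli (C * stdX j * Cᴴ)) (hZ : ∀ j, IsPauli (C * stdZ j * Cᴴ)) :
    IsClifford C := by
  have h₁ : Cᴴ * C = 1 := Matrix.mem_unitaryGroup_iff'.mp hC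
  have h₂ : C * Cᴴ = 1 := Matrix.mem_unitaryGroup_iff.mp hC
  have hone : IsPauli (1 : QMat n n) := by
    rw [← tensor_one]; exact (isPauliString_tensor fun _ => .one).isPauli
  have hsingle : ∀ j A, IsPauliMatrix A → IsPauli (C * onQubit j A * Cᴴ) := by
    rintro j A (rfl | rfl | rfl | rfl)
    · rw [onQubit_one, Matrix.mul_one, h₂]; exact hone
    · exact hX j
    · have : sigmaY = Complex.I ^ 3 • (sigmaZ * sigmaX) := by
        rw [sigmaZ_mul_sigmaX, smul_smul, ← pow_add]; simp
      rw [this, onQubit_smul, ← onQubit_mul, Matrix.mul_smul, Matrix.smul_mul,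
        ← conj_mul_conj h₁]
      exact ((hZ j).mul (hX j)).smul_I_pow 3
    · exact hZ j
  refine ⟨hC, ?_⟩
  rintro _ ⟨r, _, ⟨σ, hσ, rfl⟩, rfl⟩
  rw [Matrix.mul_smul, Matrix.smul_mul]
  refine IsPauli.smul_I_pow ?_ r
  -- Conjugation is multiplicative, so a Pauli string is assembled one qubit at a time.
  have key : ∀ s : Finset (Fin n), IsPauli (C * tensor (fun j => if j ∈ s then σ j else 1) * Cᴴ) := by
    intro s
    induction s using Finset.induction_on with
    | empty => simpa [tensor_one, h₂] using hone
    | insert a s ha ih =>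
      have : tensor (fun j => if j ∈ insert a s then σ j else 1) =
          onQubit a (σ a) * tensor (fun j => if j ∈ s then σ j else 1) := by
        rw [onQubit, tensor_mul]
        congr 1
        ext1 j
        by_cases h : j = a
        · subst h; simp [ha]
        · simp [h]
      rw [this, ← conj_mul_conj h₁]
      exact (hsingle a _ (hσ a)).mul ih
  simpa using key Finset.univ

end Pauli

/-! ## A Clifford unitary for each symplectic basis -/

section SymplecticBasis

variable {n : ℕ}

/-- In this form, right multiplication by `stdX j` shifts the column labels by the `j`-th unit
vector. -/
theorem stdX_apply (j : Fin n) (a b : Bits n) :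
    stdX j a b = if a = b + Pi.single j 1 then 1 else 0 := by
  trans ∏ i, if a i = (b + Pi.single j 1 : Bits n) i then (1 : ℂ) else 0
  swap
  · simp only [Finset.prod_ite_zero, Finset.prod_const_one, funext_iff, Finset.mem_univ,
      forall_true_left]
  rw [stdX, onQubit, tensor, Matrix.of_apply]
  refine Finset.prod_congr rfl fun i _ => ?_
  rw [Pi.add_apply]
  by_cases h : i = j
  · subst h
    simp only [Function.update_self, Pi.single_eq_same, sigmaX, Matrix.of_apply]
    generalize a i = p
    generalize b i = q
    revert p q
    have : ∀ p q : ZMod 2, p = q ↔ ¬ p = q + 1 := by decide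
    intro p q
    rw [if_congr (this p q) rfl rfl, ite_not]
  · simp [h, Matrix.one_apply]

theorem stdZ_eq_diagonal (j : Fin n) : stdZ j = Matrix.diagonal fun a : Bits n => bitSign (a j) := by
  ext a b
  rw [stdZ, onQubit, tensor, Matrix.of_apply,
    ← Finset.mul_prod_erase Finset.univ _ (Finset.mem_univ j), Function.update_self]
  by_cases hab : a = b
  · subst hab
    rw [Matrix.diagonal_apply_eq, sigmaZ, Matrix.diagonal_apply_eq, Finset.prod_eq_one, mul_one]
    intro i hi
    simp [Function.update_of_ne (Finset.ne_of_mem_erase hi)]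
  · rw [Matrix.diagonal_apply_ne _ hab]
    obtain ⟨i, hi⟩ := Function.ne_iff.mp hab
    by_cases hij : i = j
    · subst hij
      rw [sigmaZ, Matrix.diagonal_apply_ne _ hi, zero_mul]
    · rw [Finset.prod_eq_zero (Finset.mem_erase.mpr ⟨hij, Finset.mem_univ i⟩), mul_zero]
      simp [hij, hi]

/-- Operators satisfying the commutation relations of the Pauli basis have a common eigenvector. -/
theorem exists_common_eigenvector (z x : Fin n → QMat n n)
    (hz : ∀ i, z i * z i = 1) (hx : ∀ i, x i * x i = 1)
    (hzz : ∀ i j, z i * z j = z j * z i) (hzx : ∀ i j, i ≠ j → z i * x j = x j * z i)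
    (hanti : ∀ i, z i * x i = -(x i * z i)) (s : Finset (Fin n)) :
    ∃ ψ : Bits n → ℂ, ψ ≠ 0 ∧ ∀ i ∈ s, z i *ᵥ ψ = ψ := by
  induction s using Finset.induction_on with
  | empty => exact ⟨fun _ => 1, fun h => one_ne_zero (congrFun h 0), by simp⟩
  | insert j s hj ih =>
    obtain ⟨ψ, hψ, h⟩ := ih
    -- (1 + z j)ψ is fixed by `z j`. If it vanishes, ψ has eigenvalue -1 and `x j` maps it to a
    -- vector fixed by `z j`. In both cases the earlier eigenvalue equations survive, by
    -- commutation.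
    by_cases h₀ : ψ + z j *ᵥ ψ = 0
    · have hneg : z j *ᵥ ψ = -ψ := by
        rw [add_comm] at h₀; exact eq_neg_of_add_eq_zero_left h₀
      refine ⟨x j *ᵥ ψ, fun h' => hψ ?_, fun i hi => ?_⟩
      · have := congrArg (x j *ᵥ ·) h'
        simpa [Matrix.mulVec_mulVec, hx] using this
      · rcases Finset.mem_insert.mp hi with rfl | hi
        · rw [Matrix.mulVec_mulVec, hanti, Matrix.neg_mulVec, ← Matrix.mulVec_mulVec, hneg,
            Matrix.mulVec_neg, neg_neg]
        · have hij : i ≠ j := fun e => hj (e ▸ hi)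
          rw [Matrix.mulVec_mulVec, hzx i j hij, ← Matrix.mulVec_mulVec, h i hi]
    · refine ⟨_, h₀, fun i hi => ?_⟩
      rcases Finset.mem_insert.mp hi with rfl | hi
      · rw [Matrix.mulVec_add, Matrix.mulVec_mulVec, hz, Matrix.one_mulVec, add_comm]
      · rw [Matrix.mulVec_add, Matrix.mulVec_mulVec, hzz, ← Matrix.mulVec_mulVec, h i hi]

/-- Commuting involutions define a homomorphism from the bit strings, a ↦ ∏ (x i)^(a i). The ambient
group is not commutative, hence the use of `noncommPiCoprod`. -/
theorem exists_bits_hom (x : Fin n → QUnitary n) (hx : ∀ i, x i * x i = 1)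
    (hxx : ∀ i j, x i * x j = x j * x i) :
    ∃ f : Bits n → QUnitary n, (∀ a b, f (a + b) = f a * f b) ∧ ∀ i, f (Pi.single i 1) = x i := by
  let φ (i : Fin n) : Multiplicative (ZMod 2) →* QUnitary n :=
    { toFun := fun a => x i ^ (Multiplicative.toAdd a).val
      map_one' := by simp
      map_mul' := fun a b => by
        obtain ⟨a, rfl⟩ := Multiplicative.ofAdd.surjective a
        obtain ⟨b, rfl⟩ := Multiplicative.ofAdd.surjective b
        rw [← ofAdd_add, toAdd_ofAdd, toAdd_ofAdd, toAdd_ofAdd]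
        rcases bit_cases a with rfl | rfl <;> rcases bit_cases b with rfl | rfl <;>
          simp [show (1 + 1 : ZMod 2) = 0 from rfl, ZMod.val_one, hx] }
  have hcomm : Pairwise fun i j => ∀ a b, Commute (φ i a) (φ j b) := fun i j _ a b =>
    Commute.pow_pow (hxx i j) _ _
  let F := MonoidHom.noncommPiCoprod φ hcomm
  refine ⟨fun a => F fun i => Multiplicative.ofAdd (a i), fun a b => ?_, fun i => ?_⟩
  · rw [← map_mul]; rfl
  · have : (fun j => Multiplicative.ofAdd ((Pi.single i 1 : Bits n) j)) =
        Pi.mulSingle i (Multiplicative.ofAdd (1 : ZMod 2)) := by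
      ext1 j
      by_cases h : j = i
      · subst h; simp
      · simp [h]
    simp only [this, F, MonoidHom.noncommPiCoprod_mulSingle]
    simp [φ, ZMod.val_one]

/-- Moving `z i` past the product costs one sign for each factor `x i`. The relation is stable under
adding bit strings, so single bits suffice. -/
theorem mul_bits_hom (z x : Fin n → QUnitary n)
    (hzx : ∀ i j, i ≠ j → z i * x j = x j * z i)
    (hanti : ∀ i, (z i * x i : QMat n n) = -(x i * z i : QMat n n))
    (f : Bits n → QUnitary n) (hf : ∀ a b, f (a + b) = f a * f b)
    (hfx : ∀ i, f (Pi.single i 1) = x i) (i : Fin n) (a : Bits n) :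
    (z i : QMat n n) * f a = bitSign (a i) • ((f a : QMat n n) * z i) := by
  have hf0 : f 0 = 1 := by
    have := hf 0 0
    rw [add_zero] at this
    exact left_eq_mul.mp this
  rw [← Finset.univ_sum_single a]
  refine Finset.sum_induction (fun j => Pi.single (M := fun _ => ZMod 2) j (a j))
    (fun a : Bits n => (z i : QMat n n) * f a = bitSign (a i) • ((f a : QMat n n) * z i))
    (fun a b ha hb => ?_) (by simp [hf0]) (fun j _ => ?_)
  · have hs : bitSign ((a + b) i) = bitSign (a i) * bitSign (b i) := by
      rw [Pi.add_apply]
      rcases bit_cases (a i) with h | h <;> rcases bit_cases (b i) with h' | h' <;>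
        simp [h, h', show (1 + 1 : ZMod 2) = 0 from rfl]
    rw [hf, Submonoid.coe_mul, ← Matrix.mul_assoc, ha, Matrix.smul_mul, Matrix.mul_assoc, hb,
      Matrix.mul_smul, smul_smul, hs, Matrix.mul_assoc]
  · rcases bit_cases (a j) with h | h
    · simp [h, hf0]
    · rw [h, hfx]
      by_cases hij : i = j
      · subst hij
        simp [hanti]
      · have := congrArg (Subtype.val) (hzx i j hij)
        simp only [Submonoid.coe_mul] at this
        simp [hij, this]

/-- The vectors f(a)ψ are joint eigenvectors of the `z i` with sign pattern (-1)^(a i), and the `x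
i` permute them as bit flips permute basis vectors. -/
theorem exists_isBasisClifford (B : GroupedSymplecticBasis n) :
    ∃ C : QMat n n, B.IsBasisClifford C := by
  obtain ⟨hzz, hxx, hzx, hanti⟩ := B.symplectic
  have hz2 : ∀ i, (B.z i : QMat n n) * B.z i = 1 := fun i => (B.z_obs i).mul_self
  have hx2 : ∀ i, (B.x i : QMat n n) * B.x i = 1 := fun i => (B.x_obs i).mul_self
  obtain ⟨f, hf, hfx⟩ := exists_bits_hom B.x (fun i => Subtype.ext (hx2 i)) hxx
  have hfz := mul_bits_hom B.z B.x hzx hanti f hf hfx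
  obtain ⟨ψ₀, hψ₀, hzψ₀⟩ := exists_common_eigenvector (fun i => (B.z i : QMat n n))
    (fun i => (B.x i : QMat n n)) hz2 hx2 (fun i j => congrArg Subtype.val (hzz i j))
    (fun i j h => congrArg Subtype.val (hzx i j h)) hanti Finset.univ
  obtain ⟨ψ, hψ, hzψ⟩ : ∃ ψ : Bits n → ℂ, star ψ ⬝ᵥ ψ = 1 ∧ ∀ i, (B.z i : QMat n n) *ᵥ ψ = ψ := by
    have hsum : star ψ₀ ⬝ᵥ ψ₀ = ((∑ a, ‖ψ₀ a‖ ^ 2 : ℝ) : ℂ) := by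
      simp [dotProduct, ← Complex.conj_mul']
    have hpos : 0 < ∑ a, ‖ψ₀ a‖ ^ 2 := by
      obtain ⟨a, ha⟩ := Function.ne_iff.mp hψ₀
      exact Finset.sum_pos' (fun _ _ => by positivity)
        ⟨a, Finset.mem_univ a, pow_pos (norm_pos_iff.mpr ha) 2⟩
    refine ⟨((Real.sqrt (∑ a, ‖ψ₀ a‖ ^ 2))⁻¹ : ℂ) • ψ₀, ?_, fun i => by
      rw [Matrix.mulVec_smul, hzψ₀ i (Finset.mem_univ i)]⟩
    rw [star_smul, smul_dotProduct, dotProduct_smul, hsum]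
    simp only [smul_eq_mul, star_inv₀, Complex.star_def, Complex.conj_ofReal]
    norm_cast
    rw [← mul_assoc, ← mul_inv, Real.mul_self_sqrt hpos.le, inv_mul_cancel₀ hpos.ne']
  -- Column `a` is f(a)ψ.
  let C : QMat n n := Matrix.of fun b a => ((f a : QMat n n) *ᵥ ψ) b
  have hCmul : ∀ (P : QMat n n) (b a : Bits n), (P * C) b a = (P *ᵥ ((f a : QMat n n) *ᵥ ψ)) b :=
    fun P b a => rfl
  have hCZ : ∀ i, C * stdZ i = (B.z i : QMat n n) * C := by
    intro i
    ext b a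
    rw [hCmul, Matrix.mulVec_mulVec, hfz, Matrix.smul_mulVec, ← Matrix.mulVec_mulVec, hzψ,
      stdZ_eq_diagonal, Matrix.mul_diagonal, mul_comm]
    rfl
  have hCX : ∀ i, C * stdX i = (B.x i : QMat n n) * C := by
    intro i
    ext b a
    rw [hCmul, Matrix.mulVec_mulVec, ← hfx, ← Submonoid.coe_mul, ← hf, Matrix.mul_apply]
    simp only [stdX_apply, mul_ite, mul_one, mul_zero, Finset.sum_ite_eq', Finset.mem_univ, if_true]
    rw [add_comm]
    rfl
  have hCunit : Cᴴ * C = 1 := by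
    ext a b
    have hinner : (Cᴴ * C) a b =
        star ((f a : QMat n n) *ᵥ ψ) ⬝ᵥ ((f b : QMat n n) *ᵥ ψ) := rfl
    have hzf : ∀ i a, (B.z i : QMat n n) *ᵥ ((f a : QMat n n) *ᵥ ψ) =
        bitSign (a i) • ((f a : QMat n n) *ᵥ ψ) := fun i a => by
      rw [Matrix.mulVec_mulVec, hfz, Matrix.smul_mulVec, ← Matrix.mulVec_mulVec, hzψ]
    rw [hinner]
    have hun : ∀ (U : QUnitary n) (v w : Bits n → ℂ),
        star ((U : QMat n n) *ᵥ v) ⬝ᵥ ((U : QMat n n) *ᵥ w) = star v ⬝ᵥ w := fun U v w => by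
      rw [Matrix.star_mulVec, ← Matrix.dotProduct_mulVec, Matrix.mulVec_mulVec,
        ← Matrix.star_eq_conjTranspose, Matrix.mem_unitaryGroup_iff'.mp U.2, Matrix.one_mulVec]
    by_cases hab : a = b
    · subst hab
      rw [hun, hψ, Matrix.one_apply_eq]
    · rw [Matrix.one_apply_ne hab]
      obtain ⟨i, hi⟩ := Function.ne_iff.mp hab
      -- The unitary `z i` preserves the inner product of the two columns. Their eigenvalues under
      -- it are opposite, so the inner product equals its own negative.
      have h₁ := hun (B.z i) ((f a : QMat n n) *ᵥ ψ) ((f b : QMat n n) *ᵥ ψ)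
      rw [hzf, hzf, star_smul, smul_dotProduct, dotProduct_smul, smul_smul, smul_eq_mul] at h₁
      have hs : star (bitSign (a i)) * bitSign (b i) = -1 := by
        rcases bit_cases (a i) with h | h <;> rcases bit_cases (b i) with h' | h' <;>
          simp [h, h'] at hi ⊢
      rw [hs] at h₁
      linear_combination (-1 / 2 : ℂ) * h₁
  have hCU : C ∈ Matrix.unitaryGroup (Bits n) ℂ := Matrix.mem_unitaryGroup_iff'.mpr hCunit
  have hCC : C * Cᴴ = 1 := Matrix.mem_unitaryGroup_iff.mp hCU
  have hX : ∀ i, C * stdX i * Cᴴ = (B.x i : QMat n n) := fun i => by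
    rw [hCX, Matrix.mul_assoc, hCC, Matrix.mul_one]
  have hZ : ∀ i, C * stdZ i * Cᴴ = (B.z i : QMat n n) := fun i => by
    rw [hCZ, Matrix.mul_assoc, hCC, Matrix.mul_one]
  refine ⟨C, isClifford_of_generators hCU (fun i => ?_) (fun i => ?_), hZ, hX⟩
  · rw [hX]; exact (B.x_obs i).isPauli
  · rw [hZ]; exact (B.z_obs i).isPauli

end SymplecticBasis

/-! ## The linear maps enacted by lists of measurements and conditional operators -/

namespace Circuit

section Lists

variable {n : ℕ}

theorem kraus_seq {l m n : ℕ} (C : Circuit l m) (D : Circuit m n) (s : ℕ) (v : ℕ → ZMod 2) :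
    (seq C D).kraus s v = D.kraus (s + C.numOutcomes) v * C.kraus s v := rfl

theorem kraus_measureAll_cons (P : QMat n n) (l : List (QMat n n)) (s : ℕ) (v : ℕ → ZMod 2) :
    (measureAll (P :: l)).kraus s v =
      (measureAll l).kraus (s + 1) v * ((2 : ℂ)⁻¹ • (1 + bitSign (v s) • P)) := rfl

theorem kraus_condAll_cons (P : QMat n n) (T : Finset ℕ) (l : List (QMat n n × Finset ℕ)) (s : ℕ)
    (v : ℕ → ZMod 2) :
    (condAll ((P, T) :: l)).kraus s v =
      (condAll l).kraus s v * (if ∑ i ∈ T with i < s, v i = 1 then P else 1) := rfl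

theorem kraus_measureAll_append (l l' : List (QMat n n)) (s : ℕ) (v : ℕ → ZMod 2) :
    (measureAll (l ++ l')).kraus s v =
      (measureAll l').kraus (s + l.length) v * (measureAll l).kraus s v := by
  induction l generalizing s with
  | nil => exact (Matrix.mul_one _).symm
  | cons P l ih =>
    rw [List.cons_append, kraus_measureAll_cons, kraus_measureAll_cons, ih, Matrix.mul_assoc,
      List.length_cons, add_assoc s 1, add_comm 1]

theorem shift_measureAll (l : List (QMat n n)) (s : ℕ) :
    (measureAll l).shift s = measureAll l := by
  induction l with
  | nil => rfl
  | cons P l ih =>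
    change seq (measure P) ((measureAll l).shift s) = _
    rw [ih]; rfl

theorem shift_condAll (l : List (QMat n n × Finset ℕ)) (s : ℕ) :
    (condAll l).shift s = condAll (l.map fun p => (p.1, p.2.map (addRightEmbedding s))) := by
  induction l with
  | nil => rfl
  | cons P l ih =>
    change seq (condPauli P.1 (P.2.map _)) ((condAll l).shift s) = _
    rw [ih]; rfl

theorem opsValid_measureAll {l : List (QMat n n)} (h : ∀ P ∈ l, IsPauliObservable P) :
    (measureAll l).OpsValid := by
  induction l with
  | nil => trivial
  | cons P l ih =>
    exact ⟨h P List.mem_cons_self, ih fun Q hQ => h Q (List.mem_cons_of_mem _ hQ)⟩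

theorem opsValid_condAll {l : List (QMat n n × Finset ℕ)} (h : ∀ p ∈ l, IsPauli p.1) :
    (condAll l).OpsValid := by
  induction l with
  | nil => trivial
  | cons P l ih =>
    exact ⟨h P List.mem_cons_self, ih fun Q hQ => h Q (List.mem_cons_of_mem _ hQ)⟩

theorem opsValid_randomBits (n r : ℕ) : (randomBits n r).OpsValid := by
  induction r with
  | zero => trivial
  | succ r ih => exact ⟨trivial, ih⟩

theorem opsValid_shift {m n : ℕ} (C : Circuit m n) (s : ℕ) :
    (C.shift s).OpsValid ↔ C.OpsValid := by
  induction C <;> simp_all [shift, OpsValid]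

/-- The projector onto the eigenspace of `A` with eigenvalue `(-1)^b`. -/
noncomputable def eigenProj (A : Matrix (ZMod 2) (ZMod 2) ℂ) (b : ZMod 2) : Matrix (ZMod 2) (ZMod 2) ℂ :=
  (2 : ℂ)⁻¹ • (1 + bitSign b • A)

/-- The operators `A j` on the qubits `off, …, off + N - 1`, and the identity on the others. -/
def onRange (off N : ℕ) (A : ℕ → Matrix (ZMod 2) (ZMod 2) ℂ) (j : ℕ) :
    Matrix (ZMod 2) (ZMod 2) ℂ :=
  if off ≤ j ∧ j < off + N then A j else 1

/-- Measuring a conjugated single-qubit operator on consecutive qubits. -/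
theorem kraus_measureAll_ofFn {C : QMat n n} (hC : IsClifford C)
    (A : Matrix (ZMod 2) (ZMod 2) ℂ) (b : ℕ → ZMod 2) (v : ℕ → ZMod 2) (N : ℕ) :
    ∀ (off s : ℕ) (q : Fin N → Fin n) (P : Fin N → QMat n n), (∀ i, (q i : ℕ) = off + i) →
      (∀ i, P i = C * onQubit (q i) A * Cᴴ) → (∀ i < N, v (s + i) = b (off + i)) →
      (measureAll (List.ofFn P)).kraus s v =
        C * tensor (fun j : Fin n => onRange off N (fun i => eigenProj A (b i)) j) * Cᴴ := by
  have h₁ := hC.conjTranspose_mul_self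
  have h₂ := hC.mul_conjTranspose_self
  -- The outcome index `s` and the qubit offset `off` advance together but start independently: `v`
  -- is indexed by outcome, `b` by qubit.
  induction N with
  | zero =>
    intro off s q P _ _ _
    have : ∀ j : Fin n, ¬ (off ≤ (j : ℕ) ∧ (j : ℕ) < off + 0) := fun j => by omega
    simp only [onRange, this, if_false, tensor_one, Matrix.mul_one, h₂, List.ofFn_zero]
    rfl
  | succ N ih =>
    intro off s q P hq hP hv
    rw [List.ofFn_succ, kraus_measureAll_cons,
      ih (off + 1) (s + 1) (fun i => q i.succ) (fun i => P i.succ)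
        (fun i => by rw [hq, Fin.val_succ]; omega) (fun i => hP _)
        (fun i hi => by
          rw [show s + 1 + i = s + (i + 1) by omega, hv _ (by omega)]
          congr 1; omega)]
    have hhead : (2 : ℂ)⁻¹ • (1 + bitSign (v s) • P 0) =
        C * onQubit (q 0) (eigenProj A (v s)) * Cᴴ := by
      rw [hP, eigenProj, onQubit_smul, onQubit_add, onQubit_smul, onQubit_one, Matrix.mul_smul,
        Matrix.smul_mul, Matrix.mul_add, Matrix.add_mul, Matrix.mul_one, h₂, Matrix.mul_smul,
        Matrix.smul_mul]
    have h0 : (q 0 : ℕ) = off := by simpa using hq 0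
    have hv0 : v s = b off := by simpa using hv 0 (by omega)
    rw [hhead, conj_mul_conj h₁, onQubit, tensor_mul]
    congr 3
    ext1 j
    -- The head acts on qubit `off` and the tail on later qubits, so at each qubit at least one of
    -- the two factors is the identity.
    by_cases hj : j = q 0
    · subst hj
      simp [onRange, h0, hv0]
    · have : (j : ℕ) ≠ off := fun h => hj (Fin.ext (h.trans h0.symm))
      rw [Function.update_of_ne hj, Matrix.mul_one, onRange, onRange]
      refine if_congr ?_ rfl rfl
      omega

/-- Applying conditional conjugated single-qubit operators on consecutive qubits. -/
theorem kraus_condAll_ofFn {C : QMat n n} (hC : IsClifford C)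
    (A : Matrix (ZMod 2) (ZMod 2) ℂ) (b : ℕ → ZMod 2) (v : ℕ → ZMod 2) (s N : ℕ) :
    ∀ (off : ℕ) (q : Fin N → Fin n) (P : Fin N → QMat n n × Finset ℕ), (∀ i, (q i : ℕ) = off + i) →
      (∀ i, (P i).1 = C * onQubit (q i) A * Cᴴ) →
      (∀ i, ∑ t ∈ (P i).2 with t < s, v t = b (off + i)) →
      (condAll (List.ofFn P)).kraus s v =
        C * tensor (fun j : Fin n => onRange off N (fun i => if b i = 1 then A else 1) j) * Cᴴ := by
  have h₁ := hC.conjTranspose_mul_self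
  have h₂ := hC.mul_conjTranspose_self
  induction N with
  | zero =>
    intro off q P _ _ _
    have : ∀ j : Fin n, ¬ (off ≤ (j : ℕ) ∧ (j : ℕ) < off + 0) := fun j => by omega
    simp only [onRange, this, if_false, tensor_one, Matrix.mul_one, h₂, List.ofFn_zero]
    rfl
  | succ N ih =>
    intro off q P hq hP hv
    rw [List.ofFn_succ, ← Prod.mk.eta (p := P 0), kraus_condAll_cons,
      ih (off + 1) (fun i => q i.succ) (fun i => P i.succ)
        (fun i => by rw [hq, Fin.val_succ]; omega) (fun i => hP _)
        (fun i => by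
          rw [hv, Fin.val_succ]
          congr 1; omega)]
    have hhead : (if ∑ t ∈ (P 0).2 with t < s, v t = 1 then (P 0).1 else 1) =
        C * onQubit (q 0) (if b off = 1 then A else 1) * Cᴴ := by
      rw [hv, hP, Fin.val_zero, add_zero]
      split_ifs
      · rfl
      · rw [onQubit_one, Matrix.mul_one, h₂]
    have h0 : (q 0 : ℕ) = off := by simpa using hq 0
    rw [hhead, conj_mul_conj h₁, onQubit, tensor_mul]
    congr 3
    ext1 j
    by_cases hj : j = q 0
    · subst hj
      simp [onRange, h0]
    · have : (j : ℕ) ≠ off := fun h => hj (Fin.ext (h.trans h0.symm))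
      rw [Function.update_of_ne hj, Matrix.mul_one, onRange, onRange]
      refine if_congr ?_ rfl rfl
      omega

/-- An empty parity is 0, so no operator is applied. This disposes of the zero condition matrices
`Ax` and `Az`. -/
theorem kraus_condAll_eq_one {l : List (QMat n n × Finset ℕ)} {s : ℕ} {v : ℕ → ZMod 2}
    (h : ∀ p ∈ l, p.2 = ∅) : (condAll l).kraus s v = 1 := by
  induction l with
  | nil => rfl
  | cons p l ih =>
    rw [← Prod.mk.eta (p := p), kraus_condAll_cons, ih fun q hq => h q (List.mem_cons_of_mem _ hq),
      h p List.mem_cons_self]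
    simp

end Lists

end Circuit

/-! ### Discarding qubits and allocating them again. -/

theorem isClifford_one {n : ℕ} : IsClifford (1 : QMat n n) :=
  ⟨one_mem _, fun P hP => by simpa using hP⟩

/-- The matrix unit `|a⟩⟨b|` of a qubit. -/
noncomputable def ketBra (a b : ZMod 2) : Matrix (ZMod 2) (ZMod 2) ℂ := Matrix.single a b 1

/-- With no Pauli corrections on the inner qubits, allocation directly follows deallocation. Their
product is again a tensor product on all `n` qubits, so the smaller register disappears from the
computation. -/
theorem allocMat_mul_conjTranspose {m n : ℕ} (h : m ≤ n) :
    allocMat h * (allocMat h)ᴴ =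
      tensor fun j : Fin n => if (j : ℕ) < n - m then ketBra 0 0 else 1 := by
  ext a a'
  -- The restriction to the retained qubits. Row `a` of `allocMat h` can be nonzero only in column
  -- `r a`, so the sum in the matrix product has one term.
  let r (a : Bits n) : Bits m := fun j => a ⟨n - m + j, by omega⟩
  have halloc : ∀ (a : Bits n) (b : Bits m), allocMat h a b =
      if b = r a then (if ∀ i : Fin n, (i : ℕ) < n - m → a i = 0 then 1 else 0) else 0 := by
    intro a b
    rw [allocMat, Matrix.of_apply, ← ite_and]
    refine if_congr ?_ rfl rfl
    rw [and_comm, funext_iff]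
    exact and_congr_left' (forall_congr' fun j => eq_comm)
  have hprod : (∏ j : Fin n,
      (if (j : ℕ) < n - m then ketBra 0 0 else 1 : Matrix (ZMod 2) (ZMod 2) ℂ) (a j) (a' j)) =
      if ∀ j : Fin n, if (j : ℕ) < n - m then a j = 0 ∧ a' j = 0 else a j = a' j
        then 1 else 0 := by
    trans ∏ j : Fin n, if (if (j : ℕ) < n - m then a j = 0 ∧ a' j = 0 else a j = a' j)
      then (1 : ℂ) else 0
    · refine Finset.prod_congr rfl fun j _ => ?_
      by_cases hj : (j : ℕ) < n - m
      · simp only [if_pos hj]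
        rw [ketBra, Matrix.single_apply]
        exact if_congr (by rw [eq_comm, eq_comm (a := 0) (b := a' j)]) rfl rfl
      · simp only [if_neg hj]
        exact Matrix.one_apply
    · simp only [Finset.prod_ite_zero, Finset.prod_const_one, Finset.mem_univ, forall_true_left]
  rw [tensor, Matrix.of_apply, hprod, Matrix.mul_apply]
  simp only [Matrix.conjTranspose_apply, halloc]
  rw [Finset.sum_eq_single (r a) (fun b _ hb => by simp [hb]) (by simp)]
  have hiff : (∀ j : Fin n, if (j : ℕ) < n - m then a j = 0 ∧ a' j = 0 else a j = a' j) ↔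
      (∀ i : Fin n, (i : ℕ) < n - m → a i = 0) ∧ (∀ i : Fin n, (i : ℕ) < n - m → a' i = 0) ∧
        r a = r a' := by
    constructor
    · intro H
      refine ⟨fun i hi => ?_, fun i hi => ?_, ?_⟩
      · have := H i; rw [if_pos hi] at this; exact this.1
      · have := H i; rw [if_pos hi] at this; exact this.2
      · ext1 j
        have := H ⟨n - m + j, by omega⟩
        rwa [if_neg (by simp)] at this
    · rintro ⟨h₁, h₂, h₃⟩ j
      split_ifs with hj
      · exact ⟨h₁ j hj, h₂ j hj⟩
      · have := congrFun h₃ ⟨j - (n - m), by omega⟩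
        simp only [r] at this
        have e : (⟨n - m + (j - (n - m)), by omega⟩ : Fin n) = j := Fin.ext (by simp; omega)
        rwa [e] at this
  rw [if_congr hiff rfl rfl]
  rw [if_pos rfl]
  split_ifs <;> first | (exfalso; tauto) | simp

/-! ## Instruments with proportional maps -/

/-- If the nonzero maps of `Q` are multiples `c • Q' (φ r)` of pairwise non-proportional maps, and
the multiples of each map add up to it, then the instruments `Q` and `Q'` are equivalent. -/
theorem instrumentEquivalent_of_proportional {R R' V : Type} [Fintype R] [Fintype R']
    [DecidableEq R'] [AddCommGroup V] [Module ℂ V] (Q : R → V) (Q' : R' → V) (p : R → Prop)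
    [DecidablePred p] (φ : R → R') (c : ℂ) (hQ : ∀ r, Q r = if p r then c • Q' (φ r) else 0)
    (hne : ∀ r, Q' r ≠ 0) (hinj : ∀ r s (α : ℂ), Q' r = α • Q' s → r = s)
    (hcount : ∀ r', ((Finset.univ.filter fun r => p r ∧ φ r = r').card : ℂ) * c = 1) :
    InstrumentEquivalent Q Q' := by
  classical
  have hp : ∀ r, Q r ≠ 0 → p r := fun r hr => by
    by_contra h
    exact hr (by rw [hQ, if_neg h])
  have hprop : ∀ r s : {r // Q r ≠ 0}, (compressionSetoid Q) r s ↔ φ r = φ s := by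
    intro r s
    constructor
    · rintro ⟨α, h⟩
      have hc : c ≠ 0 := by
        rintro rfl
        exact r.2 (by rw [hQ]; simp)
      rw [hQ, hQ, if_pos (hp _ r.2), if_pos (hp _ s.2), smul_smul] at h
      refine hinj _ _ (c⁻¹ * (α * c)) ?_
      rw [← smul_smul, ← h, smul_smul, inv_mul_cancel₀ hc, one_smul]
    · intro h
      refine ⟨1, ?_⟩
      rw [hQ, hQ, if_pos (hp _ r.2), if_pos (hp _ s.2), h, one_smul]
  have hprop' : ∀ r s : {r // Q' r ≠ 0}, (compressionSetoid Q') r s ↔ r = s := by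
    intro r s
    refine ⟨fun ⟨α, h⟩ => Subtype.ext (hinj _ _ α h), ?_⟩
    rintro rfl
    exact (compressionSetoid Q').refl r
  let f : CompressedOutcome Q → CompressedOutcome Q' :=
    Quotient.map (fun r => ⟨φ r, hne _⟩) fun r s h =>
      (hprop' _ _).mpr (Subtype.ext ((hprop r s).mp h))
  have hf : Function.Bijective f := by
    constructor
    · intro a b h
      induction a using Quotient.ind with | _ a => ?_
      induction b using Quotient.ind with | _ b => ?_
      exact Quotient.sound ((hprop _ _).mpr
        (congrArg Subtype.val ((hprop' _ _).mp (Quotient.exact h))))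
    · intro b
      induction b using Quotient.ind with | _ b => ?_
      have hb := hcount b
      have hc : c ≠ 0 := by
        rintro rfl
        simp at hb
      -- The fibre over `b` is nonempty because its cardinality times `c` is 1.
      obtain ⟨r, hr⟩ : (Finset.univ.filter fun r => p r ∧ φ r = b).Nonempty := by
        rw [← Finset.card_pos, Nat.pos_iff_ne_zero]
        intro h0
        rw [h0] at hb
        simp at hb
      have hr := (Finset.mem_filter.mp hr).2
      have hr0 : Q r ≠ 0 := by
        rw [hQ, if_pos hr.1]
        exact smul_ne_zero hc (hne _)
      exact ⟨Quotient.mk _ ⟨r, hr0⟩, Quotient.sound ((hprop' _ _).mpr (Subtype.ext hr.2))⟩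
  refine ⟨Equiv.ofBijective f hf, fun s => ?_⟩
  induction s using Quotient.ind with | _ s => ?_
  have hr : compressed Q' (f (Quotient.mk _ s)) = Q' (φ s) := by
    rw [compressed, Finset.sum_eq_single (⟨φ s, hne _⟩ : {r // Q' r ≠ 0})]
    · intro r hr hrs
      exact absurd ((hprop' _ _).mp (Quotient.exact (Finset.mem_filter.mp hr).2)) hrs
    · intro h
      exact (h (Finset.mem_filter.mpr ⟨Finset.mem_univ _, rfl⟩)).elim
  rw [Equiv.ofBijective_apply, hr, compressed]
  have hc : c ≠ 0 := by
    rintro rfl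
    simpa using hcount (φ s)
  -- A proportionality class of `Q` is a fibre of `φ` within `p`, and all its maps are equal, so the
  -- sum is the fibre size times `c` times one map.
  calc _ = ∑ r ∈ Finset.univ.filter fun r => p r ∧ φ r = φ s, c • Q' (φ s) := by
        refine Finset.sum_bij (fun r _ => r.1) ?_ ?_ ?_ ?_
        · intro r hr
          exact Finset.mem_filter.mpr ⟨Finset.mem_univ _, hp _ r.2,
            (hprop _ _).mp (Quotient.exact (Finset.mem_filter.mp hr).2)⟩
        · intro r _ r' _ h
          exact Subtype.ext h
        · intro r hr
          have hr := (Finset.mem_filter.mp hr).2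
          have hr0 : Q r ≠ 0 := by
            rw [hQ, if_pos hr.1]
            exact smul_ne_zero hc (hne _)
          exact ⟨⟨r, hr0⟩, Finset.mem_filter.mpr ⟨Finset.mem_univ _,
            Quotient.sound ((hprop _ _).mpr hr.2)⟩, rfl⟩
        · intro r hr
          rw [hQ, if_pos (hp _ r.2), (hprop _ _).mp (Quotient.exact (Finset.mem_filter.mp hr).2)]
    _ = Q' (φ s) := by
        rw [Finset.sum_const, ← Nat.cast_smul_eq_nsmul ℂ, smul_smul, hcount, one_smul]

/-! ## Random and redundant outcomes -/

namespace Circuit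

variable {m n : ℕ} (C : Circuit m n)

/-- Flipping bit `i` is an involution that preserves probabilities and the earlier outcomes. It
exchanges the vectors with bit 0 and those with bit 1, so each set carries half of the prefix
probability. -/
theorem isRandomOutcome_of_action_update (i : Fin C.numOutcomes)
    (h : ∀ u, C.action (Function.update u i (u i + 1)) = C.action u) : C.IsRandomOutcome i := by
  classical
  intro v ρ _ hne
  have hsplit := Finset.sum_filter_add_sum_filter_not
    (Finset.univ.filter fun u : Fin C.numOutcomes → ZMod 2 => ∀ j < i, u j = v j)
    (fun u => u i = 0) (C.prob ρ)
  rw [Finset.filter_filter, Finset.filter_filter] at hsplit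
  have hflip : ∑ u : Fin C.numOutcomes → ZMod 2 with (∀ j < i, u j = v j) ∧ u i = 0, C.prob ρ u =
      ∑ u : Fin C.numOutcomes → ZMod 2 with (∀ j < i, u j = v j) ∧ ¬ u i = 0, C.prob ρ u := by
    have hinv : ∀ u : Fin C.numOutcomes → ZMod 2,
        Function.update (Function.update u i (u i + 1)) i
          (Function.update u i (u i + 1) i + 1) = u := by
      intro u
      rw [Function.update_self, Function.update_idem, add_assoc,
        show (1 + 1 : ZMod 2) = 0 from rfl, add_zero, Function.update_eq_self]
    refine Finset.sum_nbij' (fun u => Function.update u i (u i + 1))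
      (fun u => Function.update u i (u i + 1)) ?_ ?_ (fun u _ => hinv u) (fun u _ => hinv u) ?_
    · intro u hu
      obtain ⟨-, h₁, h₂⟩ := Finset.mem_filter.mp hu
      refine Finset.mem_filter.mpr ⟨Finset.mem_univ _, fun j hj => ?_, ?_⟩
      · rw [Function.update_of_ne hj.ne, h₁ j hj]
      · rw [Function.update_self, h₂]; decide
    · intro u hu
      obtain ⟨-, h₁, h₂⟩ := Finset.mem_filter.mp hu
      refine Finset.mem_filter.mpr ⟨Finset.mem_univ _, fun j hj => ?_, ?_⟩
      · rw [Function.update_of_ne hj.ne, h₁ j hj]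
      · rw [Function.update_self, (bit_cases (u i)).resolve_left h₂]; rfl
    · intro u _
      rw [prob, prob, h]
  rw [condProbZero]
  rw [← hflip] at hsplit
  have hP : C.probPrefix ρ i v = 2 *
      ∑ u : Fin C.numOutcomes → ZMod 2 with (∀ j < i, u j = v j) ∧ u i = 0, C.prob ρ u := by
    rw [probPrefix, ← hsplit, two_mul]
  rw [hP] at hne ⊢
  rw [div_eq_div_iff hne two_ne_zero]
  ring

/-- Since `i'` precedes `i`, the prefix fixes the bit at `i'`. Every vector that can occur repeats
this bit at `i`, so the conditional probability of zero is 1 or 0 for all inputs alike. -/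
theorem isRedundantOutcome_of_eq (i i' : Fin C.numOutcomes) (hlt : i' < i)
    (h : ∀ u, C.action u ≠ 0 → u i = u i') : C.IsRedundantOutcome i := by
  classical
  have hzero : ∀ ρ u, u i ≠ u i' → C.prob ρ u = 0 := by
    intro ρ u hu
    rw [prob, not_not.mp (mt (h u) hu)]
    simp
  intro v
  rcases bit_cases (v i') with hv | hv
  · right
    intro ρ _ hne
    have : ∑ u : Fin C.numOutcomes → ZMod 2 with (∀ j < i, u j = v j) ∧ u i = 0, C.prob ρ u =
        C.probPrefix ρ i v := by
      refine Finset.sum_subset (fun u hu => ?_) fun u hu hu' => hzero ρ u fun he => hu' ?_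
      · exact Finset.mem_filter.mpr ⟨Finset.mem_univ _, (Finset.mem_filter.mp hu).2.1⟩
      · have hu := (Finset.mem_filter.mp hu).2
        exact Finset.mem_filter.mpr ⟨Finset.mem_univ _, hu, by rw [he, hu i' hlt, hv]⟩
    rw [condProbZero, this, div_self hne]
  · left
    intro ρ _ _
    rw [condProbZero, Finset.sum_eq_zero, zero_div]
    intro u hu
    obtain ⟨-, h₁, h₂⟩ := Finset.mem_filter.mp hu
    refine hzero ρ u ?_
    rw [h₂, h₁ i' hlt, hv]
    exact zero_ne_one

end Circuit

/-! ## Single-qubit identities -/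

theorem eigenProj_sigmaZ (a : ZMod 2) : Circuit.eigenProj sigmaZ a = ketBra a a := by
  rcases bit_cases a with rfl | rfl <;> apply qubit_ext <;>
    simp [Circuit.eigenProj, sigmaZ, ketBra] <;> norm_num

theorem ketBra_mul_ketBra (a b c d : ZMod 2) :
    ketBra a b * ketBra c d = if b = c then ketBra a d else 0 := by
  split_ifs with h
  · subst h; simp [ketBra]
  · simp [ketBra, h]

theorem conjTranspose_ketBra (a b : ZMod 2) : (ketBra a b)ᴴ = ketBra b a := by
  simp [ketBra]

/-- The correction after a measurement resets the qubit to zero. -/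
theorem condX_mul_ketBra_self (a b : ZMod 2) :
    (if a = 1 then sigmaX else 1) * ketBra a b = ketBra 0 b := by
  rcases bit_cases a with rfl | rfl <;> rcases bit_cases b with rfl | rfl <;> apply qubit_ext <;>
    simp [sigmaX, ketBra, Matrix.single_apply, Matrix.mul_apply]

theorem condX_mul_ketBra_zero (a b : ZMod 2) :
    (if a = 1 then sigmaX else 1) * ketBra 0 b = ketBra a b := by
  rcases bit_cases a with rfl | rfl <;> rcases bit_cases b with rfl | rfl <;> apply qubit_ext <;>
    simp [sigmaX, ketBra, Matrix.single_apply, Matrix.mul_apply]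

theorem sqrt_two_mul_sqrt_two_inv : (2 : ℂ)⁻¹ = ((Real.sqrt 2 : ℝ) : ℂ)⁻¹ *
    ((Real.sqrt 2 : ℝ) : ℂ)⁻¹ := sqrt_two_inv_mul_self.symm

/-- Z exchanges |+⟩ and |-⟩, so the correction always leaves |+⟩ = H|0⟩. The outcome `b` survives
only in the overlap (-1)^(ab)/√2 of |a⟩ with the measured X eigenstate. -/
theorem condZ_mul_eigenProj_sigmaX_mul_ketBra (a b : ZMod 2) :
    (if b = 1 then sigmaZ else 1) * Circuit.eigenProj sigmaX b * ketBra a a =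
      (((Real.sqrt 2 : ℝ) : ℂ)⁻¹ * bitSign (a * b)) • (hadamard * ketBra 0 a) := by
  rcases bit_cases a with rfl | rfl <;> rcases bit_cases b with rfl | rfl <;> apply qubit_ext <;>
    simp [sigmaX, sigmaZ, hadamard, Circuit.eigenProj, ketBra, Matrix.single_apply,
      Matrix.mul_apply, sum_bit, sqrt_two_mul_sqrt_two_inv]

namespace GroupedSymplecticBasis

variable {n : ℕ} (B : GroupedSymplecticBasis n)

/-! ## The linear maps enacted by the two circuits -/

/-- The number of outcomes of the syndrome extraction circuit. -/
abbrev numS : ℕ := B.nDelta + B.nCap + B.nS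

/-- The outcomes of the general form circuit as a function of those of the two-group circuit. -/
def outcomeMap (f : ℕ → ZMod 2) (j : ℕ) : ZMod 2 :=
  if j < B.numS then f j else f (j + B.nDelta + B.nCap)

/-- The single-qubit operators whose conjugated tensor product the general form circuit enacts. -/
noncomputable def genLocal (μ : ℕ → ZMod 2) (j : ℕ) : Matrix (ZMod 2) (ZMod 2) ℂ :=
  if j < B.nDelta then hadamard * ketBra 0 (μ j)
  else if j < B.numS then ketBra (μ j) (μ j)
  else if j < B.numS + B.nM then ketBra 0 (μ j)
  else 1

/-- The factor contributed by each qubit to the map of the two-group circuit. -/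
noncomputable def localCoeff (f : ℕ → ZMod 2) (j : ℕ) : ℂ :=
  if j < B.nDelta then ((Real.sqrt 2 : ℝ) : ℂ)⁻¹ * bitSign (f j * f (B.numS + j))
  else if j < B.nDelta + B.nCap then (if f (B.numS + j) = f j then 1 else 0)
  else 1

theorem numOutcomes_measure_M :
    (Circuit.measureAll (List.ofFn (fun j => (B.xDelta j : QMat n n)) ++
      List.ofFn (fun j => (B.zCap j : QMat n n)) ++
      List.ofFn (fun j => (B.zM j : QMat n n)))).numOutcomes = B.nDelta + B.nCap + B.nM := by
  simp [add_assoc]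

/-- Each block of measurements or corrections is a conjugated tensor product. The conjugations
cancel between blocks, and one single-qubit identity per block of the basis remains. -/
theorem kraus_twoGroupCircuit {C : QMat n n} (hC : B.IsBasisClifford C) (f : ℕ → ZMod 2) :
    B.twoGroupCircuit.kraus 0 f = (∏ j : Fin n, B.localCoeff f j) •
      (C * tensor (fun j : Fin n => B.genLocal (B.outcomeMap f) j) * Cᴴ) := by
  obtain ⟨hC, hz, hx⟩ := hC
  have h₁ := hC.conjTranspose_mul_self
  have hsize := B.size_eq
  have mS₁ := Circuit.kraus_measureAll_ofFn hC sigmaZ f f B.nDelta 0 0 B.iDelta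
    (fun j => (B.zDelta j : QMat n n)) (fun i => (zero_add _).symm) (fun i => (hz _).symm)
    (fun i _ => rfl)
  have mS₂ := Circuit.kraus_measureAll_ofFn hC sigmaZ f f B.nCap B.nDelta B.nDelta B.iCap
    (fun j => (B.zCap j : QMat n n)) (fun i => rfl) (fun i => (hz _).symm) (fun i _ => rfl)
  have mS₃ := Circuit.kraus_measureAll_ofFn hC sigmaZ f f B.nS (B.nDelta + B.nCap)
    (B.nDelta + B.nCap) B.iS (fun j => (B.zS j : QMat n n)) (fun i => rfl)
    (fun i => (hz _).symm) (fun i _ => rfl)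
  have mM₁ := Circuit.kraus_measureAll_ofFn hC sigmaX (fun j => f (B.numS + j)) f B.nDelta 0
    B.numS B.iDelta (fun j => (B.xDelta j : QMat n n)) (fun i => (zero_add _).symm)
    (fun i => (hx _).symm) (fun i _ => by rw [zero_add])
  have mM₂ := Circuit.kraus_measureAll_ofFn hC sigmaZ (fun j => f (B.numS + j)) f B.nCap B.nDelta
    (B.numS + B.nDelta) B.iCap (fun j => (B.zCap j : QMat n n)) (fun i => rfl)
    (fun i => (hz _).symm) (fun i _ => by rw [add_assoc])
  -- The block of `zM` starts at qubit `numS` and its outcomes start at `numS + nDelta + nCap`, so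
  -- qubit `j` has outcome `j + nDelta + nCap`.
  have mM₃ := Circuit.kraus_measureAll_ofFn hC sigmaZ (fun j => f (j + B.nDelta + B.nCap)) f B.nM
    B.numS (B.numS + (B.nDelta + B.nCap)) B.iM (fun j => (B.zM j : QMat n n)) (fun i => rfl)
    (fun i => (hz _).symm) (fun i _ => congrArg f (by omega))
  -- The composition shifts the outcome labels of the second circuit by `numS`. All its measurements
  -- are recorded before the corrections, so the condition on the recording time holds.
  have c₁ := Circuit.kraus_condAll_ofFn hC sigmaZ (fun j => f (B.numS + j)) f
    (B.numS + (B.nDelta + B.nCap + B.nM)) B.nDelta 0 B.iDelta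
    (fun j => ((B.zDelta j : QMat n n), {(j : ℕ) + B.numS})) (fun i => (zero_add _).symm)
    (fun i => (hz _).symm) (fun i => by
      rw [Finset.sum_filter, Finset.sum_singleton, if_pos (by have := i.2; omega), zero_add,
        add_comm])
  have c₂ := Circuit.kraus_condAll_ofFn hC sigmaX (fun j => f (j + B.nDelta + B.nCap)) f
    (B.numS + (B.nDelta + B.nCap + B.nM)) B.nM B.numS B.iM
    (fun j => ((B.xM j : QMat n n), {B.nDelta + B.nCap + (j : ℕ) + B.numS})) (fun i => rfl)
    (fun i => (hx _).symm) (fun i => by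
      rw [Finset.sum_filter, Finset.sum_singleton, if_pos (by have := i.2; omega)]
      exact congrArg f (by omega))
  have hS : B.syndromeCircuit.kraus 0 f = C * tensor (fun j : Fin n =>
      Circuit.onRange (B.nDelta + B.nCap) B.nS (fun i => Circuit.eigenProj sigmaZ (f i)) j *
      (Circuit.onRange B.nDelta B.nCap (fun i => Circuit.eigenProj sigmaZ (f i)) j *
      Circuit.onRange 0 B.nDelta (fun i => Circuit.eigenProj sigmaZ (f i)) j)) * Cᴴ := by
    rw [syndromeCircuit, Circuit.kraus_measureAll_append, Circuit.kraus_measureAll_append,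
      List.length_append, List.length_ofFn, List.length_ofFn, zero_add, zero_add, mS₁, mS₂, mS₃,
      conj_mul_conj h₁, conj_mul_conj h₁, tensor_mul, tensor_mul]
  have hM : (B.deformationCircuit.shift B.numS).kraus B.numS f = C * tensor (fun j : Fin n =>
      Circuit.onRange B.numS B.nM
        (fun i => if f (i + B.nDelta + B.nCap) = 1 then sigmaX else 1) j *
      Circuit.onRange 0 B.nDelta (fun i => if f (B.numS + i) = 1 then sigmaZ else 1) j *
      (Circuit.onRange B.numS B.nM
        (fun i => Circuit.eigenProj sigmaZ (f (i + B.nDelta + B.nCap))) j *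
      (Circuit.onRange B.nDelta B.nCap (fun i => Circuit.eigenProj sigmaZ (f (B.numS + i))) j *
      Circuit.onRange 0 B.nDelta (fun i => Circuit.eigenProj sigmaX (f (B.numS + i))) j))) *
      Cᴴ := by
    rw [deformationCircuit, Circuit.shift, Circuit.shift, Circuit.shift_measureAll,
      Circuit.shift_condAll, Circuit.shift_condAll, List.map_ofFn, List.map_ofFn,
      Circuit.kraus_seq, Circuit.kraus_seq, numOutcomes_measure_M, Circuit.numOutcomes_condAll,
      add_zero, Circuit.kraus_measureAll_append, Circuit.kraus_measureAll_append,
      List.length_append, List.length_ofFn, List.length_ofFn]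
    simp only [Function.comp_def, Finset.map_singleton, addRightEmbedding_apply]
    rw [c₁, c₂, mM₁, mM₂, mM₃, conj_mul_conj h₁, conj_mul_conj h₁, conj_mul_conj h₁,
      conj_mul_conj h₁, tensor_mul, tensor_mul, tensor_mul, tensor_mul]
  rw [twoGroupCircuit, Circuit.andThen, Circuit.kraus_seq, numOutcomes_syndromeCircuit, zero_add,
    hM, hS, conj_mul_conj h₁, tensor_mul, ← Matrix.smul_mul, ← Matrix.mul_smul, ← tensor_smul]
  congr 3
  ext1 j
  obtain ⟨j, hj⟩ := j
  simp only [Circuit.onRange, localCoeff, genLocal, outcomeMap, eigenProj_sigmaZ, zero_add, zero_le,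
    true_and, numS]
  by_cases hD : j < B.nDelta
  · have e₁ : ¬ (B.nDelta ≤ j) := by omega
    have e₂ : ¬ (B.nDelta + B.nCap ≤ j) := by omega
    have e₃ : ¬ (B.nDelta + B.nCap + B.nS ≤ j) := by omega
    have e₄ : j < B.nDelta + B.nCap + B.nS := by omega
    simp only [hD, e₁, e₂, e₃, e₄, false_and, if_true, if_false, Matrix.one_mul]
    exact condZ_mul_eigenProj_sigmaX_mul_ketBra _ _
  by_cases hCap : j < B.nDelta + B.nCap
  · have e₁ : B.nDelta ≤ j := by omega
    have e₂ : ¬ (B.nDelta + B.nCap ≤ j) := by omega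
    have e₃ : ¬ (B.nDelta + B.nCap + B.nS ≤ j) := by omega
    have e₄ : j < B.nDelta + B.nCap + B.nS := by omega
    simp only [hD, hCap, e₁, e₂, e₃, e₄, false_and, true_and, if_true, if_false, Matrix.one_mul,
      Matrix.mul_one, ketBra_mul_ketBra]
    split_ifs with h
    · rw [h, one_smul]
    · rw [zero_smul]
  by_cases hS' : j < B.nDelta + B.nCap + B.nS
  · have e₁ : B.nDelta ≤ j := by omega
    have e₂ : B.nDelta + B.nCap ≤ j := by omega
    have e₃ : ¬ (B.nDelta + B.nCap + B.nS ≤ j) := by omega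
    simp only [hD, hCap, hS', e₁, e₂, e₃, false_and, true_and, and_false, if_true, if_false,
      Matrix.one_mul, Matrix.mul_one, one_smul]
  by_cases hM' : j < B.nDelta + B.nCap + B.nS + B.nM
  · have e₁ : B.nDelta ≤ j := by omega
    have e₂ : B.nDelta + B.nCap ≤ j := by omega
    have e₃ : B.nDelta + B.nCap + B.nS ≤ j := by omega
    simp only [hD, hCap, hS', hM', e₁, e₂, e₃, and_false, if_true, if_false,
      Matrix.mul_one, one_smul, and_self]
    exact condX_mul_ketBra_self _ _
  · simp only [hD, hCap, hS', hM', and_false, if_false, Matrix.one_mul, one_smul]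

theorem _root_.StabilizerCircuits.GeneralForm.mem_rowSet {N : ℕ} (a : Fin N → ZMod 2) (t : ℕ) :
    t ∈ GeneralForm.rowSet a ↔ ∃ i, a i = 1 ∧ (i : ℕ) = t := by
  simp [GeneralForm.rowSet]

/-- A row of `A` has at most one nonzero entry, so the parity it defines is a single outcome or is
empty. -/
theorem rowSet_generalForm (C : QMat n n) (i : Fin (n - (B.generalForm C).k)) :
    GeneralForm.rowSet ((B.generalForm C).A i) =
      if B.nDelta ≤ (i : ℕ) ∧ (i : ℕ) < B.numS then {(i : ℕ)} else ∅ := by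
  have hA : ∀ j, (B.generalForm C).A i j =
    if (i : ℕ) = j ∧ B.nDelta ≤ (i : ℕ) ∧ (i : ℕ) < B.nDelta + (B.nCap + B.nS) then 1 else 0 :=
    fun _ => rfl
  have h01 : ∀ p : Prop, [Decidable p] → ((if p then 1 else 0 : ZMod 2) = 1 ↔ p) := by
    intro p _
    split_ifs with h <;> simp [h]
  ext t
  simp only [GeneralForm.mem_rowSet, hA, h01, numS, ← add_assoc]
  split_ifs with h
  · simp only [Finset.mem_singleton]
    constructor
    · rintro ⟨a, ha, rfl⟩
      exact ha.1.symm
    · rintro rfl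
      exact ⟨⟨i, (zero_add (n - B.nL)).symm ▸ i.2⟩, ⟨rfl, h⟩, rfl⟩
  · simp only [Finset.notMem_empty, iff_false]
    rintro ⟨a, ha, rfl⟩
    exact h ha.2

/-- On a measured qubit, projection and reset give |0⟩⟨μ|, which reallocation leaves unchanged. The
matrix `A` then writes μ back on the blocks ∩ and S only, and the Hadamards act on Δ. -/
theorem kraus_generalForm (C : QMat n n) (μ : ℕ → ZMod 2) :
    (B.generalForm C).circuit.kraus 0 μ =
      C * tensor (fun j : Fin n => B.genLocal μ j) * Cᴴ := by
  have hsize := B.size_eq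
  have hk : n - (B.generalForm C).k = B.numS + B.nM := by
    change n - B.nL = _
    simp only [numS]
    omega
  have hnr : (B.generalForm C).nr = 0 := rfl
  have hX : ∀ j : Fin n, stdX j = 1 * onQubit j sigmaX * (1 : QMat n n)ᴴ := by simp [stdX]
  have hZ : ∀ j : Fin n, stdZ j = 1 * onQubit j sigmaZ * (1 : QMat n n)ᴴ := by simp [stdZ]
  have hempty : ∀ N, GeneralForm.rowSet (0 : Fin N → ZMod 2) = ∅ := by
    intro N
    ext
    simp [GeneralForm.rowSet]
  let q : Fin (n - (B.generalForm C).k) → Fin n := fun i => ⟨i, by omega⟩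
  have e₁ := Circuit.kraus_measureAll_ofFn isClifford_one sigmaZ μ μ _ 0 0 q
    (fun i => stdZ (q i)) (fun i => (zero_add _).symm) (fun i => hZ _) (fun i _ => rfl)
  have e₂ := Circuit.kraus_condAll_ofFn isClifford_one sigmaX μ μ (n - (B.generalForm C).k) _ 0 q
    (fun i => (stdX (q i), {(B.generalForm C).nr + (i : ℕ)})) (fun i => (zero_add _).symm)
    (fun i => hX _) (fun i => by
      rw [Finset.sum_filter, Finset.sum_singleton, if_pos (by omega), hnr])
  -- The bits `A μ`: those of μ on the blocks ∩ and S, zero elsewhere.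
  have e₃ := Circuit.kraus_condAll_ofFn isClifford_one sigmaX
    (fun j => if B.nDelta ≤ j ∧ j < B.numS then μ j else 0) μ (n - (B.generalForm C).k) _ 0 q
    (fun i => (stdX (q i), GeneralForm.rowSet ((B.generalForm C).A i)))
    (fun i => (zero_add _).symm) (fun i => hX _) (fun i => by
      rw [rowSet_generalForm, zero_add]
      split_ifs with h
      · rw [Finset.sum_filter, Finset.sum_singleton, if_pos (by omega)]
      · simp)
  have e₄ : (Circuit.condAll (List.ofFn fun j : Fin (B.generalForm C).k =>
      (stdX j, GeneralForm.rowSet ((B.generalForm C).Ax j)))).kraus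
        (n - (B.generalForm C).k) μ = 1 :=
    Circuit.kraus_condAll_eq_one fun p hp => by
      obtain ⟨i, rfl⟩ := List.mem_ofFn.mp hp
      exact hempty _
  have e₅ : (Circuit.condAll (List.ofFn fun j : Fin (B.generalForm C).k =>
      (stdZ j, GeneralForm.rowSet ((B.generalForm C).Az j)))).kraus
        (n - (B.generalForm C).k) μ = 1 :=
    Circuit.kraus_condAll_eq_one fun p hp => by
      obtain ⟨i, rfl⟩ := List.mem_ofFn.mp hp
      exact hempty _
  have e₆ := allocMat_mul_conjTranspose (B.generalForm C).k_le_nI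
  have hR : (B.generalForm C).R = C * hadamardFirst n B.nDelta := rfl
  have hL : (B.generalForm C).L = C := rfl
  have hrand : (Circuit.randomBits n 0).kraus 0 μ = 1 := rfl
  simp only [q, hnr, zero_add] at e₁ e₂ e₃
  rw [GeneralForm.circuit]
  simp only [Circuit.kraus_seq, Circuit.numOutcomes, Circuit.numOutcomes_randomBits,
    Circuit.numOutcomes_condAll, Circuit.numOutcomes_measureAll, List.length_ofFn, hnr, zero_add,
    add_zero]
  rw [e₁, e₂, e₃, e₄, e₅]
  simp only [Circuit.kraus, hrand, hR, hL, Matrix.one_mul, Matrix.mul_one,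
    Matrix.conjTranspose_one, hadamardFirst]
  -- Regrouping brings the two rectangular allocation matrices together as a square projector.
  have hassoc : ∀ (H X P₀ Xm P : QMat n n) (a : QMat n (B.generalForm C).k), a * aᴴ = P₀ →
      C * H * X * a * aᴴ * Xm * P * Cᴴ = C * (H * X * P₀ * Xm * P) * Cᴴ := by
    rintro H X _ Xm P a rfl
    simp only [Matrix.mul_assoc]
  rw [hassoc _ _ _ _ _ _ e₆, tensor_mul, tensor_mul, tensor_mul, tensor_mul, hk]
  congr 3
  ext1 j
  obtain ⟨j, hj⟩ := j
  simp only [Circuit.onRange, genLocal, eigenProj_sigmaZ, zero_add, zero_le, true_and]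
  by_cases hM : j < B.numS + B.nM
  · simp only [hM, if_true]
    rw [Matrix.mul_assoc _ _ (ketBra (μ j) (μ j)), condX_mul_ketBra_self,
      Matrix.mul_assoc _ (ketBra 0 0), ketBra_mul_ketBra, if_pos rfl,
      Matrix.mul_assoc, condX_mul_ketBra_zero]
    by_cases hD : j < B.nDelta
    · have h : ¬ B.nDelta ≤ j := by omega
      simp only [hD, h, if_true, false_and, if_false]
    · have h : B.nDelta ≤ j := by omega
      by_cases hS : j < B.numS
      · simp only [hD, h, hS, if_true, if_false, true_and, Matrix.one_mul]
      · simp only [hD, hS, if_false, and_false, Matrix.one_mul]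
  · have hD : ¬ j < B.nDelta := by simp only [numS] at hM; omega
    have hS : ¬ j < B.numS := by omega
    simp only [hM, hD, hS, if_false, Matrix.mul_one]

end GroupedSymplecticBasis

theorem Circuit.extend_of_lt {N : ℕ} (v : Fin N → ZMod 2) {i : ℕ} (h : i < N) :
    Circuit.extend v i = v ⟨i, h⟩ := by
  rw [Circuit.extend, dif_pos h]

theorem conj_conjTranspose {n : ℕ} (C P : QMat n n) : (C * P * Cᴴ)ᴴ = C * Pᴴ * Cᴴ := by
  simp [Matrix.mul_assoc]

namespace GroupedSymplecticBasis

variable {n : ℕ} (B : GroupedSymplecticBasis n)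

theorem opsValid_twoGroupCircuit : B.twoGroupCircuit.OpsValid := by
  have hlist : ∀ {N} (q : Fin N → Fin n) (P : Fin n → QUnitary n),
      (∀ i, IsPauliObservable (P i : QMat n n)) →
      ∀ Q ∈ List.ofFn (fun j => (P (q j) : QMat n n)), IsPauliObservable Q := by
    intro N q P hP Q hQ
    obtain ⟨j, rfl⟩ := List.mem_ofFn.mp hQ
    exact hP _
  refine ⟨Circuit.opsValid_measureAll fun Q hQ => ?_, (Circuit.opsValid_shift _ _).mpr
    ⟨Circuit.opsValid_measureAll fun Q hQ => ?_, Circuit.opsValid_condAll fun p hp => ?_,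
      Circuit.opsValid_condAll fun p hp => ?_⟩⟩
  · rcases List.mem_append.mp hQ with hQ | hQ
    · rcases List.mem_append.mp hQ with hQ | hQ
      · exact hlist B.iDelta B.z B.z_obs Q hQ
      · exact hlist B.iCap B.z B.z_obs Q hQ
    · exact hlist B.iS B.z B.z_obs Q hQ
  · rcases List.mem_append.mp hQ with hQ | hQ
    · rcases List.mem_append.mp hQ with hQ | hQ
      · exact hlist B.iDelta B.x B.x_obs Q hQ
      · exact hlist B.iCap B.z B.z_obs Q hQ
    · exact hlist B.iM B.z B.z_obs Q hQ
  · obtain ⟨j, rfl⟩ := List.mem_ofFn.mp hp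
    exact (B.z_obs _).isPauli
  · obtain ⟨j, rfl⟩ := List.mem_ofFn.mp hp
    exact (B.x_obs _).isPauli

/-! ## The maps of the general form circuit -/

attribute [local irreducible] Circuit.numOutcomes GeneralForm.circuit twoGroupCircuit

/-- The single-qubit operators of the projector onto the inputs with outcome `μ`. -/
noncomputable def projLocal (μ : ℕ → ZMod 2) (j : ℕ) : Matrix (ZMod 2) (ZMod 2) ℂ :=
  if j < B.numS + B.nM then ketBra (μ j) (μ j) else 1

/-- On a measured qubit the factor is |χ⟩⟨μ j| with χ a unit vector. The prepared state χ drops out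
of the Gram operator. -/
theorem conjTranspose_genLocal_mul_genLocal (μ : ℕ → ZMod 2) (j : ℕ) :
    (B.genLocal μ j)ᴴ * B.genLocal μ j = B.projLocal μ j := by
  have hnumS : B.numS = B.nDelta + B.nCap + B.nS := rfl
  simp only [genLocal, projLocal]
  by_cases hD : j < B.nDelta
  · have h : j < B.numS + B.nM := by omega
    rw [if_pos hD, if_pos h, Matrix.conjTranspose_mul, Matrix.mul_assoc,
      ← Matrix.mul_assoc _ hadamard, conjTranspose_hadamard, hadamard_mul_hadamard,
      Matrix.one_mul, conjTranspose_ketBra, ketBra_mul_ketBra, if_pos rfl]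
  by_cases hS : j < B.numS
  · have h : j < B.numS + B.nM := by omega
    rw [if_neg hD, if_pos hS, if_pos h, conjTranspose_ketBra, ketBra_mul_ketBra, if_pos rfl]
  by_cases hM : j < B.numS + B.nM
  · rw [if_neg hD, if_neg hS, if_pos hM, if_pos hM, conjTranspose_ketBra, ketBra_mul_ketBra,
      if_pos rfl]
  · rw [if_neg hD, if_neg hS, if_neg hM, if_neg hM, Matrix.conjTranspose_one, Matrix.one_mul]

theorem genLocal_mul_projLocal (μ ν : ℕ → ZMod 2) {j : ℕ} (hj : j < B.numS + B.nM)
    (h : μ j ≠ ν j) : B.genLocal μ j * B.projLocal ν j = 0 := by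
  simp only [genLocal, projLocal, if_pos hj]
  split_ifs
  · rw [Matrix.mul_assoc, ketBra_mul_ketBra, if_neg h, Matrix.mul_zero]
  · rw [ketBra_mul_ketBra, if_neg h]
  · rw [ketBra_mul_ketBra, if_neg h]

theorem numOutcomes_generalForm (C : QMat n n) :
    (B.generalForm C).circuit.numOutcomes = B.numS + B.nM := by
  have hnumS : B.numS = B.nDelta + B.nCap + B.nS := rfl
  have := B.size_eq
  rw [GeneralForm.numOutcomes_circuit]
  change 0 + (n - B.nL) = _
  simp only [numS]
  omega

theorem size_eq' : B.numS + B.nM + B.nL = n := B.size_eq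

theorem linMap_generalForm (C : QMat n n) (m) :
    (B.generalForm C).circuit.linMap m =
      C * tensor (fun j : Fin n => B.genLocal (Circuit.extend m) j) * Cᴴ :=
  B.kraus_generalForm C _

theorem conjTranspose_linMap_generalForm_mul {C : QMat n n} (hC : IsClifford C) (m) :
    ((B.generalForm C).circuit.linMap m)ᴴ * (B.generalForm C).circuit.linMap m =
      C * tensor (fun j : Fin n => B.projLocal (Circuit.extend m) j) * Cᴴ := by
  rw [linMap_generalForm, conj_conjTranspose, conj_mul_conj hC.conjTranspose_mul_self,
    conjTranspose_tensor, tensor_mul]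
  simp only [conjTranspose_genLocal_mul_genLocal]

theorem sum_tensor_projLocal (C : QMat n n) :
    ∑ m : Fin (B.generalForm C).circuit.numOutcomes → ZMod 2,
      tensor (fun j : Fin n => B.projLocal (Circuit.extend m) j) = 1 := by
  have hnumS : B.numS = B.nDelta + B.nCap + B.nS := rfl
  have hN := B.numOutcomes_generalForm C
  have hsize := B.size_eq'
  ext a b
  rw [Matrix.sum_apply]
  simp only [tensor, Matrix.of_apply]
  by_cases hab : a = b
  · subst hab
    rw [Matrix.one_apply_eq]
    -- Only the outcome that reads off the measured bits of `a` contributes to this diagonal entry.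
    refine (Finset.sum_eq_single (fun i : Fin _ => a ⟨i, by have := i.2; omega⟩) ?_ ?_).trans ?_
    rotate_left 2
    · refine Finset.prod_eq_one fun j _ => ?_
      rw [projLocal]
      by_cases hj : (j : ℕ) < B.numS + B.nM
      · rw [if_pos hj, Circuit.extend_of_lt _ (by omega), ketBra, Matrix.single_apply, if_pos]
        exact ⟨rfl, rfl⟩
      · rw [if_neg hj, Matrix.one_apply_eq]
    · intro m _ hm
      obtain ⟨i, hi⟩ := Function.ne_iff.mp hm
      refine Finset.prod_eq_zero (Finset.mem_univ (⟨i, by have := i.2; omega⟩ : Fin n)) ?_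
      rw [projLocal, if_pos (by have := i.2; simp only; omega), Circuit.extend_of_lt _ i.2, ketBra,
        Matrix.single_apply, if_neg]
      exact fun h => hi h.1
    · exact fun h => absurd (Finset.mem_univ _) h
  · rw [Matrix.one_apply_ne hab]
    obtain ⟨j, hj⟩ := Function.ne_iff.mp hab
    refine Finset.sum_eq_zero fun m _ => Finset.prod_eq_zero (Finset.mem_univ j) ?_
    rw [projLocal]
    split_ifs
    · rw [ketBra, Matrix.single_apply, if_neg]
      exact fun h => hj (h.1.symm.trans h.2)
    · exact Matrix.one_apply_ne hj

theorem sum_linMap_generalForm {C : QMat n n} (hC : IsClifford C) :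
    ∑ m, ((B.generalForm C).circuit.linMap m)ᴴ * (B.generalForm C).circuit.linMap m = 1 := by
  simp only [B.conjTranspose_linMap_generalForm_mul hC]
  rw [← Finset.sum_mul, ← Finset.mul_sum, sum_tensor_projLocal, Matrix.mul_one,
    hC.mul_conjTranspose_self]

theorem linMap_generalForm_ne_zero {C : QMat n n} (hC : IsClifford C) (m) :
    (B.generalForm C).circuit.linMap m ≠ 0 := by
  have hN := B.numOutcomes_generalForm C
  intro h
  have h' := B.conjTranspose_linMap_generalForm_mul hC m
  rw [h, Matrix.mul_zero] at h'
  have h₁ := hC.conjTranspose_mul_self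
  have h0 : tensor (fun j : Fin n => B.projLocal (Circuit.extend m) j) = 0 := by
    calc _ = (Cᴴ * C) * tensor (fun j : Fin n => B.projLocal (Circuit.extend m) j) * (Cᴴ * C) := by
          rw [h₁, Matrix.one_mul, Matrix.mul_one]
      _ = Cᴴ * (C * tensor (fun j : Fin n => B.projLocal (Circuit.extend m) j) * Cᴴ) * C := by
          simp only [Matrix.mul_assoc]
      _ = 0 := by rw [← h', Matrix.mul_zero, Matrix.zero_mul]
  -- A diagonal entry of the projector at μ itself. The zeros supplied by `extend` on the inner
  -- qubits are harmless, as the factor there is the identity.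
  have h1 : tensor (fun j : Fin n => B.projLocal (Circuit.extend m) j)
      (fun j => Circuit.extend m j) (fun j => Circuit.extend m j) = 1 := by
    rw [tensor, Matrix.of_apply]
    refine Finset.prod_eq_one fun j _ => ?_
    rw [projLocal]
    split_ifs
    · rw [ketBra, Matrix.single_apply, if_pos ⟨rfl, rfl⟩]
    · exact Matrix.one_apply_eq _
  rw [h0] at h1
  exact zero_ne_one h1

theorem action_apply {m n : ℕ} (D : Circuit m n) (v) (ρ : QMat m m) :
    D.action v ρ = D.linMap v * ρ * (D.linMap v)ᴴ := rfl

open scoped ComplexOrder in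
theorem action_ne_zero {m n : ℕ} {D : Circuit m n} {v} (h : D.linMap v ≠ 0) : D.action v ≠ 0 := by
  intro h0
  -- On the identity, the action gives QQᴴ, which vanishes only if Q does.
  have := LinearMap.congr_fun h0 1
  rw [action_apply, Matrix.mul_one, LinearMap.zero_apply,
    Matrix.self_mul_conjTranspose_eq_zero] at this
  exact h this

theorem action_generalForm_ne_zero {C : QMat n n} (hC : IsClifford C) (m) :
    (B.generalForm C).circuit.action m ≠ 0 :=
  action_ne_zero (B.linMap_generalForm_ne_zero hC m)

open scoped ComplexOrder in
-- Distinct outcomes project the input onto orthogonal subspaces. The input QᴴQ, with Q the operator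
-- of `m`, is killed by the operator of `m'` but not by Q.
theorem eq_of_action_generalForm {C : QMat n n} (hC : IsClifford C)
    (m m' : Fin (B.generalForm C).circuit.numOutcomes → ZMod 2) (α : ℂ)
    (h : (B.generalForm C).circuit.action m = α • (B.generalForm C).circuit.action m') :
    m = m' := by
  have hnumS : B.numS = B.nDelta + B.nCap + B.nS := rfl
  have hN := B.numOutcomes_generalForm C
  have hsize := B.size_eq'
  by_contra hne
  obtain ⟨i, hi⟩ := Function.ne_iff.mp hne
  have hlt := i.2
  have hzero : (B.generalForm C).circuit.linMap m' *
      (((B.generalForm C).circuit.linMap m)ᴴ * (B.generalForm C).circuit.linMap m) = 0 := by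
    rw [B.conjTranspose_linMap_generalForm_mul hC, linMap_generalForm,
      conj_mul_conj hC.conjTranspose_mul_self, tensor_mul,
      tensor_eq_zero (⟨i, by omega⟩ : Fin n), Matrix.mul_zero, Matrix.zero_mul]
    refine B.genLocal_mul_projLocal _ _ (by simp only; omega) ?_
    rw [Circuit.extend_of_lt _ hlt, Circuit.extend_of_lt _ hlt]
    exact Ne.symm hi
  have := LinearMap.congr_fun h
    (((B.generalForm C).circuit.linMap m)ᴴ * (B.generalForm C).circuit.linMap m)
  rw [LinearMap.smul_apply, action_apply, action_apply, hzero, Matrix.zero_mul, smul_zero] at this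
  refine B.linMap_generalForm_ne_zero hC m ?_
  -- The image of QᴴQ is (QQᴴ)(QQᴴ)ᴴ, so its vanishing forces QQᴴ = 0 and then Q = 0.
  rw [← Matrix.self_mul_conjTranspose_eq_zero, ← Matrix.self_mul_conjTranspose_eq_zero, ← this]
  simp only [Matrix.conjTranspose_mul, Matrix.conjTranspose_conjTranspose, Matrix.mul_assoc]

/-! ## The maps of the two-group circuit -/

/-- The outcome of the general form circuit which corresponds to an outcome of the two-group
circuit. -/
def outcome (C : QMat n n) (v : Fin B.twoGroupCircuit.numOutcomes → ZMod 2) :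
    Fin (B.generalForm C).circuit.numOutcomes → ZMod 2 :=
  fun i => B.outcomeMap (Circuit.extend v) i

/-- The two measurements of each operator in `zCap` agree. -/
def Consistent (v : Fin B.twoGroupCircuit.numOutcomes → ZMod 2) : Prop :=
  ∀ j, v (B.posMCap j) = v (B.posSCap j)

instance : DecidablePred B.Consistent := fun _ => by unfold Consistent; infer_instance

theorem genLocal_congr {μ ν : ℕ → ZMod 2} (h : ∀ j < B.numS + B.nM, μ j = ν j) (j : ℕ) :
    B.genLocal μ j = B.genLocal ν j := by
  have hnumS : B.numS = B.nDelta + B.nCap + B.nS := rfl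
  simp only [genLocal]
  by_cases hj : j < B.numS + B.nM
  · rw [h j hj]
  · have hD : ¬ j < B.nDelta := by omega
    have hS : ¬ j < B.numS := by omega
    simp only [hj, hD, hS, if_false]

/-- Both circuits have the same local factors, so their operators differ only by the scalar
collected over the qubits. -/
theorem linMap_twoGroupCircuit {C : QMat n n} (hC : B.IsBasisClifford C) (v) :
    B.twoGroupCircuit.linMap v = (∏ j : Fin n, B.localCoeff (Circuit.extend v) j) •
      (B.generalForm C).circuit.linMap (B.outcome C v) := by
  have hnumS : B.numS = B.nDelta + B.nCap + B.nS := rfl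
  have hN := B.numOutcomes_generalForm C
  rw [linMap_generalForm, Circuit.linMap, B.kraus_twoGroupCircuit hC]
  congr 4
  ext1 j
  refine B.genLocal_congr (fun j hj => ?_) j
  rw [Circuit.extend_of_lt _ (by omega), outcome]

/-- The squared modulus erases the sign (-1)^(ab), the only trace of the `xDelta` outcomes. -/
theorem localCoeff_mul_star (f : ℕ → ZMod 2) (j : ℕ) :
    B.localCoeff f j * star (B.localCoeff f j) =
      if j < B.nDelta then (2 : ℂ)⁻¹
      else if j < B.nDelta + B.nCap then (if f (B.numS + j) = f j then 1 else 0) else 1 := by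
  rw [localCoeff]
  split_ifs
  · have hs : star (bitSign (f j * f (B.numS + j))) = bitSign (f j * f (B.numS + j)) := by
      rcases bit_cases (f j * f (B.numS + j)) with h | h <;> simp [h]
    rw [star_mul', hs, Complex.star_def, map_inv₀, Complex.conj_ofReal, mul_mul_mul_comm,
      bitSign_mul_self, sqrt_two_inv_mul_self, mul_one]
  all_goals simp

theorem extend_posMCap (v : Fin B.twoGroupCircuit.numOutcomes → ZMod 2) (j : Fin B.nCap) :
    Circuit.extend v (B.numS + (B.nDelta + j)) = v (B.posMCap j) :=
  Circuit.extend_of_lt v (B.posMCap j).2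

theorem extend_posSCap (v : Fin B.twoGroupCircuit.numOutcomes → ZMod 2) (j : Fin B.nCap) :
    Circuit.extend v (B.nDelta + j) = v (B.posSCap j) :=
  Circuit.extend_of_lt v (B.posSCap j).2

theorem prod_localCoeff_mul_star (v : Fin B.twoGroupCircuit.numOutcomes → ZMod 2) :
    (∏ j : Fin n, B.localCoeff (Circuit.extend v) j) *
      star (∏ j : Fin n, B.localCoeff (Circuit.extend v) j) =
      if B.Consistent v then (2 : ℂ)⁻¹ ^ B.nDelta else 0 := by
  have hnumS : B.numS = B.nDelta + B.nCap + B.nS := rfl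
  have hsize := B.size_eq
  rw [star_prod, ← Finset.prod_mul_distrib]
  simp only [localCoeff_mul_star]
  split_ifs with hv
  · have : ∀ j : Fin n, (if (j : ℕ) < B.nDelta then (2 : ℂ)⁻¹
        else if (j : ℕ) < B.nDelta + B.nCap then
          (if Circuit.extend v (B.numS + j) = Circuit.extend v j then 1 else 0) else 1) =
        if (j : ℕ) < B.nDelta then (2 : ℂ)⁻¹ else 1 := by
      intro j
      split_ifs with h₁ h₂ h₃
      · rfl
      · rfl
      · have := hv ⟨j - B.nDelta, by omega⟩
        rw [← B.extend_posMCap v, ← B.extend_posSCap v] at this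
        simp only [show B.nDelta + ((j : ℕ) - B.nDelta) = j by omega] at this
        exact absurd this h₃
      · rfl
    rw [Finset.prod_congr rfl fun j _ => this j, Finset.prod_ite, Finset.prod_const_one, mul_one,
      Finset.prod_const, Fin.card_filter_val_lt, min_eq_right (by omega)]
  · obtain ⟨j, hj⟩ := not_forall.mp hv
    refine Finset.prod_eq_zero (Finset.mem_univ (B.iCap j)) ?_
    have h₁ : ¬ (B.nDelta + (j : ℕ) < B.nDelta) := by omega
    have h₂ : B.nDelta + (j : ℕ) < B.nDelta + B.nCap := by omega
    simp only [iCap, h₁, h₂, if_true, if_false, extend_posMCap, extend_posSCap, hj]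

/-- The central formula: all `xDelta` outcomes carry equal weight, and consistency decides which
vectors occur. -/
theorem action_twoGroupCircuit {C : QMat n n} (hC : B.IsBasisClifford C) (v) :
    B.twoGroupCircuit.action v =
      if B.Consistent v then (2 : ℂ)⁻¹ ^ B.nDelta •
        (B.generalForm C).circuit.action (B.outcome C v) else 0 := by
  rw [← ite_zero_smul, ← prod_localCoeff_mul_star]
  ext1 ρ
  rw [LinearMap.smul_apply, action_apply, action_apply, B.linMap_twoGroupCircuit hC,
    Matrix.conjTranspose_smul, Matrix.smul_mul, Matrix.smul_mul, Matrix.mul_smul, smul_smul]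

theorem action_twoGroupCircuit_ne_zero_iff {C : QMat n n} (hC : B.IsBasisClifford C) (v) :
    B.twoGroupCircuit.action v ≠ 0 ↔ B.Consistent v := by
  rw [B.action_twoGroupCircuit hC]
  split_ifs with h
  · simp only [h, iff_true]
    exact smul_ne_zero (pow_ne_zero _ (by norm_num)) (B.action_generalForm_ne_zero hC.1 _)
  · simp [h]

/-- Each outcome of the general form circuit corresponds to `2 ^ nDelta` outcomes of the two-group
circuit. -/
theorem sum_consistent {W : Type*} [AddCommMonoid W] (C : QMat n n)
    (F : (Fin (B.generalForm C).circuit.numOutcomes → ZMod 2) → W) :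
    ∑ v with B.Consistent v, F (B.outcome C v) = 2 ^ B.nDelta • ∑ m, F m := by
  have hnumS : B.numS = B.nDelta + B.nCap + B.nS := rfl
  have hN := B.numOutcomes_generalForm C
  have hN' := B.numOutcomes_twoGroupCircuit
  have hcard : ∑ p : (Fin (B.generalForm C).circuit.numOutcomes → ZMod 2) ×
      (Fin B.nDelta → ZMod 2), F p.1 = 2 ^ B.nDelta • ∑ m, F m := by
    rw [Fintype.sum_prod_type, Finset.smul_sum]
    refine Finset.sum_congr rfl fun m _ => ?_
    change ∑ _b : Fin B.nDelta → ZMod 2, F m = _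
    rw [Finset.sum_const, Finset.card_univ, Fintype.card_fun, ZMod.card, Fintype.card_fin]
  rw [← hcard]
  -- The inverse map, by position: the syndrome outcomes come from `m`; the `xDelta` outcomes are
  -- the free bits; the second `zCap` outcomes copy the first, which sit `numS` places earlier; the
  -- `zM` outcomes come from the last block of `m`.
  let g (p : (Fin (B.generalForm C).circuit.numOutcomes → ZMod 2) × (Fin B.nDelta → ZMod 2))
      (i : ℕ) : ZMod 2 :=
    if i < B.numS then Circuit.extend p.1 i
    else if i < B.numS + B.nDelta then Circuit.extend p.2 (i - B.numS)
    else if i < B.numS + (B.nDelta + B.nCap) then Circuit.extend p.1 (i - B.numS)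
    else Circuit.extend p.1 (i - (B.nDelta + B.nCap))
  have hg : ∀ p i, i < B.twoGroupCircuit.numOutcomes →
      Circuit.extend (fun i : Fin B.twoGroupCircuit.numOutcomes => g p i) i = g p i :=
    fun p i hi => Circuit.extend_of_lt _ hi
  refine Finset.sum_bij' (fun v _ => (B.outcome C v, fun j => v (B.posMDelta j)))
    (fun p _ i => g p i) (fun _ _ => Finset.mem_univ _) ?_ ?_ ?_ (fun _ _ => rfl)
  · intro p _
    refine Finset.mem_filter.mpr ⟨Finset.mem_univ _, fun j => ?_⟩
    have hj := j.2
    simp only [posMCap, posSCap, g]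
    rw [if_neg (by omega), if_neg (by omega), if_pos (by omega), if_pos (by omega)]
    congr 1
    omega
  · intro v hv
    have hv := (Finset.mem_filter.mp hv).2
    have ho : ∀ i < B.numS + B.nM, Circuit.extend (B.outcome C v) i =
        B.outcomeMap (Circuit.extend v) i := fun i hi => Circuit.extend_of_lt _ (by omega)
    ext1 i
    have hi := i.2
    rw [← Fin.eta i i.2, ← Circuit.extend_of_lt v i.2]
    simp only [g]
    split_ifs with h₁ h₂ h₃
    · rw [ho _ (by omega), outcomeMap, if_pos h₁]
    · rw [Circuit.extend_of_lt _ (by omega : (i : ℕ) - B.numS < B.nDelta), posMDelta,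
        Circuit.extend_of_lt v i.2]
      congr 2
      simp only
      omega
    -- Consistency is used here only: a second `zCap` outcome is recovered from the first.
    · have := hv ⟨i - B.numS - B.nDelta, by omega⟩
      rw [← B.extend_posMCap v, ← B.extend_posSCap v] at this
      rw [ho _ (by omega), outcomeMap,
        if_pos (by omega)]
      simp only at this
      rw [show B.numS + (B.nDelta + ((i : ℕ) - B.numS - B.nDelta)) = i by omega,
        show B.nDelta + ((i : ℕ) - B.numS - B.nDelta) = i - B.numS by omega] at this
      exact this.symm
    · rw [ho _ (by omega), outcomeMap, if_neg (by omega)]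
      congr 1
      omega
  · intro p _
    refine Prod.ext ?_ ?_
    · ext1 i
      have hi := i.2
      simp only [outcome, outcomeMap]
      rw [← Circuit.extend_of_lt p.1 i.2]
      split_ifs with h
      · rw [hg _ _ (by omega)]
        simp only [g, if_pos h]
      · rw [hg _ _ (by omega)]
        simp only [g]
        rw [if_neg (by omega), if_neg (by omega), if_neg (by omega)]
        congr 1
        omega
    · ext1 j
      have hj := j.2
      simp only [posMDelta, g]
      rw [if_neg (by omega), if_pos (by omega), ← Circuit.extend_of_lt p.2 j.2]
      congr 1
      omega

/-- Trace preservation is inherited from the general form circuit, as 2^nDelta preimages of weight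
2^(-nDelta) add up to one. -/
theorem sum_linMap_twoGroupCircuit {C : QMat n n} (hC : B.IsBasisClifford C) :
    ∑ v, (B.twoGroupCircuit.linMap v)ᴴ * B.twoGroupCircuit.linMap v = 1 := by
  have h : ∀ v, (B.twoGroupCircuit.linMap v)ᴴ * B.twoGroupCircuit.linMap v =
      if B.Consistent v then (2 : ℂ)⁻¹ ^ B.nDelta •
        (((B.generalForm C).circuit.linMap (B.outcome C v))ᴴ *
          (B.generalForm C).circuit.linMap (B.outcome C v)) else 0 := by
    intro v
    rw [← ite_zero_smul, ← prod_localCoeff_mul_star, B.linMap_twoGroupCircuit hC,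
      Matrix.conjTranspose_smul, Matrix.smul_mul, Matrix.mul_smul, smul_smul, mul_comm]
  rw [Finset.sum_congr rfl fun v _ => h v, ← Finset.sum_filter, B.sum_consistent C fun m =>
    (2 : ℂ)⁻¹ ^ B.nDelta • (((B.generalForm C).circuit.linMap m)ᴴ *
      (B.generalForm C).circuit.linMap m), ← Finset.smul_sum, B.sum_linMap_generalForm hC.1,
    ← Nat.cast_smul_eq_nsmul ℂ, smul_smul, Nat.cast_pow, ← mul_pow]
  norm_num

theorem equivalent_generalForm {C : QMat n n} (hC : B.IsBasisClifford C) :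
    B.twoGroupCircuit.Equivalent (B.generalForm C).circuit := by
  refine instrumentEquivalent_of_proportional _ _ B.Consistent (B.outcome C) _
    (B.action_twoGroupCircuit hC) (B.action_generalForm_ne_zero hC.1)
    (B.eq_of_action_generalForm hC.1) fun m => ?_
  -- Summing the indicator of `m` counts the consistent preimages of `m`.
  have h := B.sum_consistent C fun m' => if m' = m then 1 else 0
  rw [Finset.sum_boole, Finset.filter_filter, Finset.sum_ite_eq' , if_pos (Finset.mem_univ _)] at h
  rw [Nat.cast_id, smul_eq_mul, mul_one] at h
  rw [h, Nat.cast_pow, ← mul_pow]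
  norm_num

/-- The four blocks cover every measured qubit, so the blockwise relation determines `m` completely.
-/
theorem outcomeRelation_iff (C : QMat n n) (v : Fin B.twoGroupCircuit.numOutcomes → ZMod 2)
    (m : Fin (B.generalForm C).circuit.numOutcomes → ZMod 2) :
    B.OutcomeRelation C v m ↔ m = B.outcome C v := by
  have hnumS : B.numS = B.nDelta + B.nCap + B.nS := rfl
  have hN := B.numOutcomes_generalForm C
  have hN' := B.numOutcomes_twoGroupCircuit
  have hsize := B.size_eq
  have hm : ∀ i : Fin (n - B.nL), m ((B.generalForm C).posM i) = Circuit.extend m i := by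
    intro i
    have := i.2
    rw [Circuit.extend_of_lt m (by omega)]
    exact congrArg m (Fin.ext (zero_add _))
  have hSD : ∀ j, v (B.posSDelta j) = Circuit.extend v j := fun j =>
    (Circuit.extend_of_lt v (B.posSDelta j).2).symm
  have hSC : ∀ j, v (B.posSCap j) = Circuit.extend v (B.nDelta + j) := fun j =>
    (B.extend_posSCap v j).symm
  have hSS : ∀ j, v (B.posSS j) = Circuit.extend v (B.nDelta + B.nCap + j) := fun j =>
    (Circuit.extend_of_lt v (B.posSS j).2).symm
  have hMM : ∀ j, v (B.posMM j) = Circuit.extend v (B.numS + (B.nDelta + B.nCap + j)) := fun j =>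
    (Circuit.extend_of_lt v (B.posMM j).2).symm
  have hout : m = B.outcome C v ↔ ∀ i : Fin (n - B.nL),
      Circuit.extend m i = B.outcomeMap (Circuit.extend v) i := by
    constructor
    · rintro rfl i
      have := i.2
      exact Circuit.extend_of_lt _ (by omega)
    · intro h
      ext1 i
      have := i.2
      have := h ⟨i, by omega⟩
      rwa [Circuit.extend_of_lt m i.2] at this
  rw [hout, OutcomeRelation]
  refine forall_congr' fun i => ?_
  rw [hm]
  simp only [hSD, hSC, hSS, hMM, outcomeMap]
  have hi := i.2
  generalize (i : ℕ) = i at hi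
  constructor
  · rintro ⟨h₁, h₂, h₃, h₄⟩
    by_cases hD : i < B.nDelta
    · rw [if_pos (by omega), h₁ ⟨i, hD⟩ rfl]
    by_cases hCap : i < B.nDelta + B.nCap
    · rw [if_pos (by omega), h₂ ⟨i - B.nDelta, by omega⟩ (by simp only; omega)]
      congr 1
      simp only
      omega
    by_cases hS : i < B.numS
    · rw [if_pos hS, h₃ ⟨i - (B.nDelta + B.nCap), by omega⟩ (by simp only; omega)]
      congr 1
      simp only
      omega
    · rw [if_neg hS, h₄ ⟨i - B.numS, by omega⟩ (by
        simp only; omega)]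
      congr 1
      simp only
      omega
  · intro h
    refine ⟨?_, ?_, ?_, ?_⟩
    · rintro j rfl
      rw [h, if_pos (by have := j.2; omega)]
    · rintro j rfl
      rw [h, if_pos (by have := j.2; omega)]
    · rintro j rfl
      rw [h, if_pos (by have := j.2; omega)]
    · rintro j rfl
      rw [h, if_neg (by omega)]
      congr 1
      omega

/-- The outcome attached to `v` works with factor 2^(-nDelta), and no other does because distinct
general form actions are not proportional. -/
theorem sameAction_iff {C : QMat n n} (hC : B.IsBasisClifford C)
    (v : Fin B.twoGroupCircuit.numOutcomes → ZMod 2) (hv : B.twoGroupCircuit.action v ≠ 0)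
    (m : Fin (B.generalForm C).circuit.numOutcomes → ZMod 2) :
    SameAction B.twoGroupCircuit (B.generalForm C).circuit v m ↔ B.OutcomeRelation C v m := by
  have hcons := (B.action_twoGroupCircuit_ne_zero_iff hC v).mp hv
  have hact := B.action_twoGroupCircuit hC v
  rw [if_pos hcons] at hact
  rw [outcomeRelation_iff]
  constructor
  · rintro ⟨-, -, α, hα, h⟩
    rw [hact] at h
    refine (B.eq_of_action_generalForm hC.1 _ _ ((2 ^ B.nDelta : ℂ) * α) ?_).symm
    rw [← smul_smul, ← h, smul_smul, ← mul_pow]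
    norm_num
  · rintro rfl
    refine ⟨hv, B.action_generalForm_ne_zero hC.1 _, 2⁻¹ ^ B.nDelta, by positivity, ?_⟩
    rw [hact]
    push_cast
    rfl

/-- The corresponding outcome and the consistency condition read only positions below `numS` or from
`numS + nDelta` on. The gap holds exactly the `xDelta` outcomes. -/
theorem action_eq_of_eq_off_posMDelta (v w : Fin B.twoGroupCircuit.numOutcomes → ZMod 2)
    (h : ∀ i, (∀ j, i ≠ B.posMDelta j) → v i = w i) :
    B.twoGroupCircuit.action v = B.twoGroupCircuit.action w := by
  have hnumS : B.numS = B.nDelta + B.nCap + B.nS := rfl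
  -- The claim does not mention `C`; any choice serves.
  obtain ⟨C, hC⟩ := exists_isBasisClifford B
  have hN := B.numOutcomes_generalForm C
  have hN' := B.numOutcomes_twoGroupCircuit
  have hext : ∀ i, (i < B.numS ∨ B.numS + B.nDelta ≤ i) → Circuit.extend v i = Circuit.extend w i := by
    intro i hi
    by_cases hlt : i < B.twoGroupCircuit.numOutcomes
    · rw [Circuit.extend_of_lt _ hlt, Circuit.extend_of_lt _ hlt]
      refine h _ fun j hj => ?_
      have := congrArg Fin.val hj
      simp only [posMDelta] at this
      have := j.2
      omega
    · rw [Circuit.extend, Circuit.extend, dif_neg hlt, dif_neg hlt]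
  have hout : B.outcome C v = B.outcome C w := by
    ext1 i
    simp only [outcome, outcomeMap]
    split_ifs with hi
    · exact hext _ (Or.inl hi)
    · exact hext _ (Or.inr (by omega))
  have hcons : B.Consistent v ↔ B.Consistent w := by
    refine forall_congr' fun j => ?_
    rw [← B.extend_posMCap v, ← B.extend_posSCap v, ← B.extend_posMCap w, ← B.extend_posSCap w,
      hext _ (Or.inr (by omega)), hext _ (Or.inl (by have := j.2; omega))]
  rw [B.action_twoGroupCircuit hC, B.action_twoGroupCircuit hC, hout]
  exact if_congr hcons rfl rfl

end GroupedSymplecticBasis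

/-! ### Validity of general form circuits and the main theorem. -/

theorem GeneralForm.opsValid_circuit {nI nO : ℕ} (G : GeneralForm nI nO) (hL : IsClifford G.L)
    (hR : IsClifford G.R) : G.circuit.OpsValid := by
  refine ⟨Circuit.opsValid_randomBits _ _, hL.conjTranspose,
    Circuit.opsValid_measureAll fun Q hQ => ?_, Circuit.opsValid_condAll fun p hp => ?_, trivial,
    Circuit.opsValid_condAll fun p hp => ?_, Circuit.opsValid_condAll fun p hp => ?_, trivial,
    Circuit.opsValid_condAll fun p hp => ?_, hR⟩
  · obtain ⟨j, rfl⟩ := List.mem_ofFn.mp hQ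
    exact ⟨_, isPauliString_stdZ _, Or.inl rfl⟩
  · obtain ⟨j, rfl⟩ := List.mem_ofFn.mp hp
    exact (isPauliString_stdX _).isPauli
  · obtain ⟨j, rfl⟩ := List.mem_ofFn.mp hp
    exact (isPauliString_stdX _).isPauli
  · obtain ⟨j, rfl⟩ := List.mem_ofFn.mp hp
    exact (isPauliString_stdZ _).isPauli
  · obtain ⟨j, rfl⟩ := List.mem_ofFn.mp hp
    exact (isPauliString_stdX _).isPauli

end StabilizerCircuits

theorem mainTheorem5 {n : ℕ} (S M : Subgroup (QUnitary n))
    (hS : IsStabilizerGroup S) (hM : IsStabilizerGroup M)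
    (B : GroupedSymplecticBasis n) (hB : B.IsCommonBasis S M) :
    -- the Clifford unitary which maps the standard Pauli basis to `B` exists
    (∃ C : QMat n n, B.IsBasisClifford C) ∧
    ∀ C : QMat n n, B.IsBasisClifford C →
      -- both circuits are stabilizer circuits, and they are equivalent
      B.twoGroupCircuit.IsStabilizerCircuit ∧
      IsClifford (B.generalForm C).L ∧ IsClifford (B.generalForm C).R ∧
      (B.generalForm C).circuit.IsStabilizerCircuit ∧
      B.twoGroupCircuit.Equivalent (B.generalForm C).circuit ∧
      -- the relation between the outcomes
      (∀ v, B.twoGroupCircuit.action v ≠ 0 → ∀ m,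
        SameAction B.twoGroupCircuit (B.generalForm C).circuit v m ↔ B.OutcomeRelation C v m) ∧
      -- the outcomes of `xDelta` are random, and the action does not depend on them
      (∀ j, B.twoGroupCircuit.IsRandomOutcome (B.posMDelta j)) ∧
      (∀ v w, (∀ i, (∀ j, i ≠ B.posMDelta j) → v i = w i) →
        B.twoGroupCircuit.action v = B.twoGroupCircuit.action w) ∧
      -- the second outcomes of `zCap` are redundant, and equal to the first ones
      (∀ j, B.twoGroupCircuit.IsRedundantOutcome (B.posMCap j)) ∧
      (∀ v, B.twoGroupCircuit.action v ≠ 0 ↔ ∀ j, v (B.posMCap j) = v (B.posSCap j)) := by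
  refine ⟨exists_isBasisClifford B, fun C hC => ?_⟩
  have hR : IsClifford (B.generalForm C).R := hC.1.mul (isClifford_hadamardFirst n B.nDelta)
  refine ⟨⟨B.opsValid_twoGroupCircuit, B.sum_linMap_twoGroupCircuit hC⟩, hC.1, hR,
    ⟨(B.generalForm C).opsValid_circuit hC.1 hR, B.sum_linMap_generalForm hC.1⟩,
    B.equivalent_generalForm hC, B.sameAction_iff hC, fun j => ?_,
    B.action_eq_of_eq_off_posMDelta, fun j => ?_, B.action_twoGroupCircuit_ne_zero_iff hC⟩
  -- Flipping one `xDelta` outcome is a change to which the action is insensitive.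
  · exact Circuit.isRandomOutcome_of_action_update _ _ fun u =>
      B.action_eq_of_eq_off_posMDelta _ _ fun i hi => Function.update_of_ne (hi j) _ _
  · refine Circuit.isRedundantOutcome_of_eq _ _ (B.posSCap j) ?_ fun u hu =>
      (B.action_twoGroupCircuit_ne_zero_iff hC u).mp hu j
    simp only [Fin.lt_def, GroupedSymplecticBasis.posSCap, GroupedSymplecticBasis.posMCap]
    omega
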